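/- Let $H=L^2((0,1);\mathbb{R})$ (Lebesgue measure), and let $e_0(x)=1$, $e_n(x)=\sqrt2\cos(2n\pi x)$, $e_{-n}(x)=\sqrt2\sin(2n\pi x)$ for $n\in\mathbb{N}=\{1,2,\dots\}$. Let $A\colon D(A)\subseteq H\to H$ be the Laplacian with periodic boundary conditions, i.e. $D(A)=\{v\in H\colon \sum_{n\in\mathbb{Z}}n^4|\langle e_n,v\rangle_H|^2<\infty\}$ and $Av=\sum_{n\in\mathbb{Z}}-4\pi^2n^2\langle e_n,v\rangle_H e_n$ for $v\in D(A)$. Let $T,\eta\in(0,\infty)$ and let $(H_r)_{r\in\mathbb{R}}$ be the interpolation spaces associated to $\eta-A$: for $r\ge 0$, $H_r=D((\eta-A)^r)$ with norm $\|(\eta-A)^r v\|_H$, and for $r<0$, $H_r$ is the completion of $H$ with respect to the norm $\|(\eta-A)^{r}v\|_H$. For $N\in\mathbb{N}$, $v\in H$ let $P_N(v)=\sum_{n=-N}^{N}\langle e_n,v\rangle_H e_n$. Let $(\Omega,\mathcal{F},\mathbb{P})$ be a probability space, let $q\in\{2,3,\dots\}$, $a_0,\dots,a_{q-1}\in\mathbb{R}$,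 $a_q\in\mathbb{R}\setminus\{0\}$, $\chi\in(\tfrac14,\infty)$, $\nu\in(\tfrac14,\tfrac34)$, $\xi\in H_\chi$, and let $W\colon[0,T]\times\Omega\to H_{-\nu}$ be an $\mathrm{Id}_H$-cylindrical Wiener process. For every $N\in\mathbb{N}$ let $S_N\colon H_{-\nu}\to H$ be one of the two operators $e^{\frac TN A}$ or $(I-\frac TN A)^{-1}$ (extended continuously from $H$ to $H_{-\nu}$; the choice may depend on $N$). Let $Y^N\colon\{0,1,\dots,N\}\times\Omega\to H$, $N\in\mathbb{N}$, be the processes which satisfy $Y^N_0=P_N(\xi)$ and, for all $n\in\{0,1,\dots,N-1\}$, $$Y^N_{n+1}=P_NS_N\Big(Y^N_n+\tfrac TN\Big(\sum_{k=0}^{q}a_k[Y^N_n]^k\Big)+\big(W_{\frac{(n+1)T}{N}}-W_{\frac{nT}{N}}\big)\Big),$$ where $[v]^k$ denotes the pointwise $k$-th power of $v$. Then for all $p\in(0,\infty)$ it holds that $\liminf_{N\to\infty}\mathbb{E}\big[\|Y^N_N\|_H^p\big]=\infty$. (The case $S_N=e^{\frac TN A}$ for all $N$ is the full-discrete exponential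 Euler scheme and the case $S_N=(I-\frac TN A)^{-1}$ for all $N$ is the full-discrete linear-implicit Euler scheme; $q=3$, $a_0=a_2=0$, $a_1>0$, $a_3<0$ is the case of stochastic Allen--Cahn equations.) -/

import Mathlib

open MeasureTheory ProbabilityTheory Filter
open scoped ENNReal NNReal Topology

namespace EulerSPDE

noncomputable section

/-- The Lebesgue measure on the interval `(0,1)`. -/
abbrev lam : Measure ℝ := (volume : Measure ℝ).restrict (Set.Ioo 0 1)

/-- The real Hilbert space `H = L²((0,1); ℝ)`. -/
abbrev H : Type := Lp ℝ 2 lam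

/-- The functions `1`, `√2 cos(2nπx)` (index `n ≥ 1`) and `√2 sin(2nπx)` (index `-n ≤ -1`). -/
def trigFun (n : ℤ) (x : ℝ) : ℝ :=
  if n = 0 then 1
  else if 0 < n then √2 * Real.cos (2 * n * Real.pi * x)
  else √2 * Real.sin (2 * (-n : ℤ) * Real.pi * x)

lemma continuous_trigFun (n : ℤ) : Continuous (trigFun n) := by
  unfold trigFun
  split_ifs <;> fun_prop

lemma memLp_trigFun (n : ℤ) : MemLp (trigFun n) 2 lam := by
  refine MemLp.of_bound (continuous_trigFun n).aestronglyMeasurable (√2)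
    (Eventually.of_forall fun x => ?_)
  have h0 : (0 : ℝ) ≤ √2 := Real.sqrt_nonneg 2
  unfold trigFun
  split_ifs
  · simp
  · rw [norm_mul, Real.norm_of_nonneg h0]
    exact mul_le_of_le_one_right h0 (Real.abs_cos_le_one _)
  · rw [norm_mul, Real.norm_of_nonneg h0]
    exact mul_le_of_le_one_right h0 (Real.abs_sin_le_one _)

/-- The trigonometric functions `e n ∈ H`, `n ∈ ℤ`. -/
def e (n : ℤ) : H := (memLp_trigFun n).toLp (trigFun n)

lemma intervalIntegral_cos (k : ℤ) :
    ∫ x in (0 : ℝ)..1, Real.cos (2 * k * Real.pi * x) = if k = 0 then 1 else 0 := by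
  split_ifs with h
  · simp [h]
  · have hk : (2 * (k : ℝ) * Real.pi) ≠ 0 := by
      have : (k : ℝ) ≠ 0 := by exact_mod_cast h
      positivity
    rw [intervalIntegral.integral_comp_mul_left (fun x => Real.cos x) hk, integral_cos]
    have : Real.sin (2 * (k : ℝ) * Real.pi) = 0 := by
      have := Real.sin_int_mul_pi (2 * k)
      push_cast at this
      exact this
    simp [this]

lemma intervalIntegral_sin (k : ℤ) :
    ∫ x in (0 : ℝ)..1, Real.sin (2 * k * Real.pi * x) = 0 := by
  by_cases h : k = 0
  · simp [h]
  · have hk : (2 * (k : ℝ) * Real.pi) ≠ 0 := by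
      have : (k : ℝ) ≠ 0 := by exact_mod_cast h
      positivity
    rw [intervalIntegral.integral_comp_mul_left (fun x => Real.sin x) hk, integral_sin]
    have : Real.cos (2 * (k : ℝ) * Real.pi) = 1 := by
      have := Real.cos_int_mul_two_pi k
      rwa [show (k : ℝ) * (2 * Real.pi) = 2 * k * Real.pi by ring] at this
    simp [this]

lemma inner_e (m n : ℤ) :
    inner ℝ (e m) (e n) = ∫ x in (0 : ℝ)..1, trigFun m x * trigFun n x := by
  rw [MeasureTheory.L2.inner_def, intervalIntegral.integral_of_le zero_le_one,
    integral_Ioc_eq_integral_Ioo]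
  refine integral_congr_ae ?_
  filter_upwards [(memLp_trigFun m).coeFn_toLp, (memLp_trigFun n).coeFn_toLp] with x hm hn
  simp only [e, hm, hn]
  simp [mul_comm]

lemma intervalIntegral_cos_mul_cos (m n : ℤ) :
    ∫ x in (0 : ℝ)..1, (√2 * Real.cos (2 * m * Real.pi * x)) * (√2 * Real.cos (2 * n * Real.pi * x))
      = (if m - n = 0 then 1 else 0) + (if m + n = 0 then 1 else 0) := by
  rw [← intervalIntegral_cos, ← intervalIntegral_cos, ← intervalIntegral.integral_add
    (Continuous.intervalIntegrable (by fun_prop) _ _)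
    (Continuous.intervalIntegrable (by fun_prop) _ _)]
  congr 1
  ext x
  push_cast
  rw [show 2 * ((m : ℝ) - n) * Real.pi * x = 2 * m * Real.pi * x - 2 * n * Real.pi * x by ring,
    show 2 * ((m : ℝ) + n) * Real.pi * x = 2 * m * Real.pi * x + 2 * n * Real.pi * x by ring,
    Real.cos_sub, Real.cos_add]
  have : √2 * √2 = (2 : ℝ) := Real.mul_self_sqrt (by norm_num)
  linear_combination (Real.cos (2 * m * Real.pi * x) * Real.cos (2 * n * Real.pi * x)) * this

lemma intervalIntegral_sin_mul_sin (m n : ℤ) :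
    ∫ x in (0 : ℝ)..1, (√2 * Real.sin (2 * m * Real.pi * x)) * (√2 * Real.sin (2 * n * Real.pi * x))
      = (if m - n = 0 then 1 else 0) - (if m + n = 0 then 1 else 0) := by
  rw [← intervalIntegral_cos, ← intervalIntegral_cos, ← intervalIntegral.integral_sub
    (Continuous.intervalIntegrable (by fun_prop) _ _)
    (Continuous.intervalIntegrable (by fun_prop) _ _)]
  congr 1
  ext x
  push_cast
  rw [show 2 * ((m : ℝ) - n) * Real.pi * x = 2 * m * Real.pi * x - 2 * n * Real.pi * x by ring,
    show 2 * ((m : ℝ) + n) * Real.pi * x = 2 * m * Real.pi * x + 2 * n * Real.pi * x by ring,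
    Real.cos_sub, Real.cos_add]
  have : √2 * √2 = (2 : ℝ) := Real.mul_self_sqrt (by norm_num)
  linear_combination (Real.sin (2 * m * Real.pi * x) * Real.sin (2 * n * Real.pi * x)) * this

lemma intervalIntegral_cos_mul_sin (m n : ℤ) :
    ∫ x in (0 : ℝ)..1, (√2 * Real.cos (2 * m * Real.pi * x)) * (√2 * Real.sin (2 * n * Real.pi * x))
      = 0 := by
  have h : (∫ x in (0 : ℝ)..1, Real.sin (2 * (m + n : ℤ) * Real.pi * x))
      - ∫ x in (0 : ℝ)..1, Real.sin (2 * (m - n : ℤ) * Real.pi * x) = 0 := by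
    rw [intervalIntegral_sin, intervalIntegral_sin, sub_zero]
  refine Eq.trans ?_ h
  rw [← intervalIntegral.integral_sub
    (Continuous.intervalIntegrable (by fun_prop) _ _)
    (Continuous.intervalIntegrable (by fun_prop) _ _)]
  congr 1
  ext x
  push_cast
  rw [show 2 * ((m : ℝ) - n) * Real.pi * x = 2 * m * Real.pi * x - 2 * n * Real.pi * x by ring,
    show 2 * ((m : ℝ) + n) * Real.pi * x = 2 * m * Real.pi * x + 2 * n * Real.pi * x by ring,
    Real.sin_sub, Real.sin_add]
  have : √2 * √2 = (2 : ℝ) := Real.mul_self_sqrt (by norm_num)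
  linear_combination (Real.cos (2 * m * Real.pi * x) * Real.sin (2 * n * Real.pi * x)) * this

lemma orthonormal_e : Orthonormal ℝ e := by
  classical
  rw [orthonormal_iff_ite]
  intro m n
  rw [inner_e]
  have hs0 : √2 ≠ (0 : ℝ) := by positivity
  rcases lt_trichotomy m 0 with hm | rfl | hm <;> rcases lt_trichotomy n 0 with hn | rfl | hn
  · simp only [trigFun, hm.ne, hn.ne, hm.not_gt, hn.not_gt, if_false]
    rw [intervalIntegral_sin_mul_sin]
    grind
  · simp only [trigFun, hm.ne, hm.not_gt, if_false, if_true, mul_one]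
    rw [intervalIntegral.integral_const_mul, intervalIntegral_sin]
    simp
  · simp only [trigFun, hm.ne, hn.ne', hm.not_gt, hn, if_false, if_true]
    rw [if_neg (by grind)]
    simp_rw [mul_comm (√2 * Real.sin _)]
    exact intervalIntegral_cos_mul_sin n (-m)
  · simp only [trigFun, hn.ne, hn.not_gt, if_false, if_true, one_mul]
    rw [intervalIntegral.integral_const_mul, intervalIntegral_sin]
    simp [hn.ne']
  · simp [trigFun]
  · simp only [trigFun, hn.ne', hn, if_false, if_true, one_mul]
    rw [intervalIntegral.integral_const_mul, intervalIntegral_cos]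
    simp [hn.ne', hn.ne]
  · simp only [trigFun, hm.ne', hm, hn.ne, hn.not_gt, if_false, if_true]
    rw [if_neg (by grind)]
    exact intervalIntegral_cos_mul_sin m (-n)
  · simp only [trigFun, hm.ne', hm, if_false, if_true, mul_one]
    rw [intervalIntegral.integral_const_mul, intervalIntegral_cos]
    simp [hm.ne']
  · simp only [trigFun, hm.ne', hm, hn.ne', hn, if_false, if_true]
    rw [intervalIntegral_cos_mul_cos]
    grind

lemma summable_smul_e {c : ℤ → ℝ} (hc : Summable fun n => c n ^ 2) :
    Summable fun n => c n • e n := by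
  have := (orthonormal_e.orthogonalFamily.summable_iff_norm_sq_summable c).2
    (by simpa using hc)
  simpa using this

lemma norm_sq_tsum_smul_e {c : ℤ → ℝ} (hc : Summable fun n => c n ^ 2) :
    ‖∑' n, c n • e n‖ ^ 2 = ∑' n, c n ^ 2 := by
  have hm : Memℓp c 2 := by
    rw [memℓp_gen_iff (by norm_num)]
    simpa using hc
  have h1 := orthonormal_e.orthogonalFamily.linearIsometry.norm_map (⟨c, hm⟩ : lp (fun _ : ℤ => ℝ) 2)
  rw [OrthogonalFamily.linearIsometry_apply] at h1
  have h2 := lp.norm_rpow_eq_tsum (p := 2) (by norm_num) (⟨c, hm⟩ : lp (fun _ : ℤ => ℝ) 2)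
  simp at h1 h2
  rw [h1, h2]

lemma summable_inner_sq (v : H) : Summable fun n => inner ℝ (e n) v ^ 2 := by
  simpa using orthonormal_e.inner_products_summable v

lemma tsum_inner_sq_le (v : H) : ∑' n, inner ℝ (e n) v ^ 2 ≤ ‖v‖ ^ 2 := by
  simpa using orthonormal_e.tsum_inner_products_le v

/-- The (in general unbounded) linear operator on `H` which is diagonal with respect to
`(e n)` with eigenvalues `m n`: its domain is `{v | ∑ₙ |m n ⟨e n, v⟩|² < ∞}` and it maps `v` to
`∑ₙ m n ⟨e n, v⟩ e n`. -/
def diag (m : ℤ → ℝ) : H →ₗ.[ℝ] H where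
  domain :=
    { carrier := {v | Summable fun n => (m n * inner ℝ (e n) v) ^ 2}
      zero_mem' := by simp
      add_mem' := by
        intro u v hu hv
        refine Summable.of_nonneg_of_le (fun n => sq_nonneg _) (fun n => ?_)
          ((hu.mul_left 2).add (hv.mul_left 2))
        rw [inner_add_right]
        nlinarith [sq_nonneg (m n * inner ℝ (e n) u - m n * inner ℝ (e n) v)]
      smul_mem' := by
        intro c v hv
        refine (Summable.mul_left (c ^ 2) hv).congr fun n => ?_
        rw [real_inner_smul_right]
        ring }
  toFun :=
    { toFun := fun v => ∑' n, (m n * inner ℝ (e n) (v : H)) • e n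
      map_add' := by
        rintro ⟨u, hu⟩ ⟨v, hv⟩
        rw [← (summable_smul_e hu).tsum_add (summable_smul_e hv)]
        refine tsum_congr fun n => ?_
        simp only [Submodule.coe_add, inner_add_right, mul_add, add_smul]
      map_smul' := by
        rintro c ⟨v, hv⟩
        rw [RingHom.id_apply, ← (summable_smul_e hv).tsum_const_smul c]
        refine tsum_congr fun n => ?_
        simp only [Submodule.coe_smul, real_inner_smul_right, smul_smul]
        congr 1
        ring }

lemma mem_diag_domain {m : ℤ → ℝ} {v : H} :
    v ∈ (diag m).domain ↔ Summable fun n => (m n * inner ℝ (e n) v) ^ 2 := Iff.rfl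

lemma diag_apply (m : ℤ → ℝ) (v : (diag m).domain) :
    diag m v = ∑' n, (m n * inner ℝ (e n) (v : H)) • e n := rfl

/-- The Laplacian `A` with periodic boundary conditions, `A e n = -4π²n² e n`. -/
def A : H →ₗ.[ℝ] H := diag fun n => -4 * Real.pi ^ 2 * (n : ℝ) ^ 2

lemma mem_A_domain {v : H} :
    v ∈ A.domain ↔ Summable fun n : ℤ => (n : ℝ) ^ 4 * |inner ℝ (e n) v| ^ 2 := by
  have h : ((-4 * Real.pi ^ 2) ^ 2 : ℝ) ≠ 0 := by
    have := Real.pi_ne_zero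
    positivity
  rw [A, mem_diag_domain,
    ← summable_mul_left_iff (f := fun n : ℤ => (n : ℝ) ^ 4 * |inner ℝ (e n) v| ^ 2) h]
  refine summable_congr fun n => ?_
  rw [sq_abs]
  ring

/-- The fractional power `(η - A)^r`, `r ∈ ℝ`. -/
def fracPow (η r : ℝ) : H →ₗ.[ℝ] H := diag fun n => (η + 4 * Real.pi ^ 2 * (n : ℝ) ^ 2) ^ r

/-- The operator `e^{tA}` of the semigroup generated by `A`. -/
def expA (t : ℝ) : H →ₗ.[ℝ] H := diag fun n => Real.exp (t * (-4 * Real.pi ^ 2 * (n : ℝ) ^ 2))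

/-- The domain `D((η - A)^r)`, regarded as a space with the inner product
`⟨(η - A)^r u, (η - A)^r v⟩` and the corresponding norm. -/
def PowDomain (η r : ℝ) : Type := (fracPow η r).domain

namespace PowDomain

variable (η r : ℝ)

instance : AddCommGroup (PowDomain η r) := inferInstanceAs (AddCommGroup (fracPow η r).domain)

instance : Module ℝ (PowDomain η r) := inferInstanceAs (Module ℝ (fracPow η r).domain)

/-- `(η - A)^r` as a linear map on its domain. -/
def pow : PowDomain η r →ₗ[ℝ] H := (fracPow η r).toFun

instance : SeminormedAddCommGroup (PowDomain η r) :=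
  SeminormedAddCommGroup.induced (PowDomain η r) H (pow η r)

instance : InnerProductSpace ℝ (PowDomain η r) where
  norm_smul_le c v := by
    change ‖pow η r (c • v)‖ ≤ ‖c‖ * ‖pow η r v‖
    rw [map_smul, norm_smul]
  inner u v := inner ℝ (pow η r u) (pow η r v)
  norm_sq_eq_re_inner v := norm_sq_eq_re_inner (𝕜 := ℝ) (pow η r v)
  conj_inner_symm u v := inner_conj_symm (𝕜 := ℝ) (pow η r u) (pow η r v)
  add_left u v w := by rw [map_add, inner_add_left]
  smul_left u v c := by rw [map_smul, inner_smul_left]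

lemma norm_def (v : PowDomain η r) : ‖v‖ = ‖pow η r v‖ := rfl

end PowDomain

/-- The interpolation space `H_r` associated to `η - A`: the completion of `D((η - A)^r)` with
respect to the norm `‖(η - A)^r v‖`. For `r ≥ 0` and `η > 0` the space `D((η - A)^r)` is already
complete, so that `H_r` is `D((η - A)^r)` itself; for `r ≤ 0` one has `D((η - A)^r) = H` and `H_r`
is the completion of `H` with respect to a weaker norm. -/
abbrev InterpSpace (η r : ℝ) : Type := UniformSpace.Completion (PowDomain η r)

instance (η r : ℝ) : MeasurableSpace (InterpSpace η r) := borel _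

instance (η r : ℝ) : BorelSpace (InterpSpace η r) := ⟨rfl⟩

lemma fracPow_weight_le {η ν : ℝ} (hη : 0 < η) (hν : 0 ≤ ν) (n : ℤ) :
    (η + 4 * Real.pi ^ 2 * (n : ℝ) ^ 2) ^ (-ν) ≤ η ^ (-ν) :=
  Real.rpow_le_rpow_of_nonpos hη (le_add_of_nonneg_right (by positivity)) (by linarith)

lemma sq_weight_inner_le {η ν : ℝ} (hη : 0 < η) (hν : 0 ≤ ν) (v : H) (n : ℤ) :
    ((η + 4 * Real.pi ^ 2 * (n : ℝ) ^ 2) ^ (-ν) * inner ℝ (e n) v) ^ 2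
      ≤ (η ^ (-ν)) ^ 2 * inner ℝ (e n) v ^ 2 := by
  rw [mul_pow]
  exact mul_le_mul_of_nonneg_right
    (pow_le_pow_left₀ (by positivity) (fracPow_weight_le hη hν n) 2) (sq_nonneg _)

lemma mem_fracPow_neg_domain {η ν : ℝ} (hη : 0 < η) (hν : 0 ≤ ν) (v : H) :
    v ∈ (fracPow η (-ν)).domain :=
  Summable.of_nonneg_of_le (fun _ => sq_nonneg _) (sq_weight_inner_le hη hν v)
    ((summable_inner_sq v).mul_left _)

/-- `H → D((η - A)^{-ν}) = H`, the identity on underlying elements. -/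
def toPowDomain {η ν : ℝ} (hη : 0 < η) (hν : 0 ≤ ν) : H →ₗ[ℝ] PowDomain η (-ν) :=
  LinearMap.codRestrict (fracPow η (-ν)).domain LinearMap.id (mem_fracPow_neg_domain hη hν)

lemma norm_toPowDomain_le {η ν : ℝ} (hη : 0 < η) (hν : 0 ≤ ν) (v : H) :
    ‖toPowDomain hη hν v‖ ≤ η ^ (-ν) * ‖v‖ := by
  have hs := mem_fracPow_neg_domain hη hν v
  refine le_of_sq_le_sq ?_ (by positivity)
  calc ‖toPowDomain hη hν v‖ ^ 2
      = ∑' n : ℤ, ((η + 4 * Real.pi ^ 2 * (n : ℝ) ^ 2) ^ (-ν) * inner ℝ (e n) v) ^ 2 :=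
        norm_sq_tsum_smul_e hs
    _ ≤ ∑' n : ℤ, (η ^ (-ν)) ^ 2 * inner ℝ (e n) v ^ 2 :=
        Summable.tsum_le_tsum (sq_weight_inner_le hη hν v) hs ((summable_inner_sq v).mul_left _)
    _ = (η ^ (-ν)) ^ 2 * ∑' n : ℤ, inner ℝ (e n) v ^ 2 := tsum_mul_left
    _ ≤ (η ^ (-ν)) ^ 2 * ‖v‖ ^ 2 := by
        gcongr
        exact tsum_inner_sq_le v
    _ = (η ^ (-ν) * ‖v‖) ^ 2 := by ring

/-- The continuous dense embedding `H ↪ H_{-ν}` for `ν ≥ 0`. -/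
def embed {η ν : ℝ} (hη : 0 < η) (hν : 0 ≤ ν) : H →L[ℝ] InterpSpace η (-ν) :=
  (UniformSpace.Completion.toComplL (𝕜 := ℝ) (E := PowDomain η (-ν))).comp
    ((toPowDomain hη hν).mkContinuous (η ^ (-ν)) (norm_toPowDomain_le hη hν))

/-- The projection `P_N v = ∑_{n=-N}^{N} ⟨e n, v⟩ e n`. -/
def P (N : ℕ) (v : H) : H := ∑ n ∈ Finset.Icc (-(N : ℤ)) N, inner ℝ (e n) v • e n

open Classical in
/-- The Nemytskii operator `v ↦ ∑_{k=0}^{q} a_k [v]^k` (pointwise powers), with values in `H`. It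
is given the value `0` at those `v` for which the pointwise polynomial of `v` is not square
integrable; this does not happen for trigonometric polynomials `v`, in particular it never
happens along the numerical schemes below. -/
def nemytskii (q : ℕ) (a : ℕ → ℝ) (v : H) : H :=
  if h : MemLp (fun x => ∑ k ∈ Finset.range (q + 1), a k * (v x) ^ k) 2 lam then h.toLp _ else 0

/-- `W` is, on the time interval `[0,T]`, an `Id_H`-cylindrical Wiener process with values in the
space `E`, into which `H` is embedded by `J`: it starts at `0`, has continuous paths and
independent increments, and `W_t - W_s` is centred Gaussian with covariance `(t-s) J J*`, i.e. for
every continuous linear functional `φ` on `E` the real random variable `φ (W_t - W_s)` is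
`N(0, (t-s) ‖φ ∘ J‖²)`-distributed. -/
structure IsCylindricalWiener {Ω E : Type*} [MeasurableSpace Ω] [NormedAddCommGroup E]
    [NormedSpace ℝ E] [MeasurableSpace E] (J : H →L[ℝ] E) (T : ℝ) (W : ℝ → Ω → E)
    (μ : Measure Ω) : Prop where
  measurable : ∀ t ∈ Set.Icc 0 T, Measurable (W t)
  zero : ∀ᵐ ω ∂μ, W 0 ω = 0
  continuous : ∀ᵐ ω ∂μ, ContinuousOn (fun t => W t ω) (Set.Icc 0 T)
  indep : HasIndepIncrements (fun (t : Set.Icc (0 : ℝ) T) ω => W t ω) μ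
  law : ∀ s t : ℝ, 0 ≤ s → s ≤ t → t ≤ T → ∀ φ : E →L[ℝ] ℝ,
    HasLaw (fun ω => φ (W t ω - W s ω)) (gaussianReal 0 ((t - s) * ‖φ.comp J‖ ^ 2).toNNReal) μ

/-- The bounded operator `S : E → H` is (the continuous extension to `E` of) `e^{tA}`, where `H`
is densely embedded into `E` by `J`. -/
def IsExp {E : Type*} [NormedAddCommGroup E] [NormedSpace ℝ E] (J : H →L[ℝ] E) (t : ℝ)
    (S : E →L[ℝ] H) : Prop :=
  ∀ v : H, ∃ hv : v ∈ (expA t).domain, S (J v) = expA t ⟨v, hv⟩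

/-- The bounded operator `S : E → H` is (the continuous extension to `E` of) the inverse
`(I - tA)^{-1} : H → D(A)` of `I - tA : D(A) → H`, where `H` is densely embedded into `E`
by `J`. -/
structure IsResolvent {E : Type*} [NormedAddCommGroup E] [NormedSpace ℝ E] (J : H →L[ℝ] E) (t : ℝ)
    (S : E →L[ℝ] H) : Prop where
  right_inv : ∀ v : H, ∃ hv : S (J v) ∈ A.domain, S (J v) - t • A ⟨S (J v), hv⟩ = v
  left_inv : ∀ u : A.domain, S (J (u - t • A u)) = u

end

end EulerSPDE

/-!
The schemes diverge because a single unlikely but not too unlikely Gaussian increment makes them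
explode doubly exponentially.

Write `h = T / N`, let `c n j = ⟨e j, Y N n⟩` be the Fourier coefficients of the scheme and `s j`
the eigenvalues of `S N`. Then `c (n + 1) j = s j * ∫ e_j g(Y N n) + Z n j` for `|j| ≤ N`
(`inner_P_step`), where `g y = y + h ∑ a_k y ^ k` is the explicit Euler map and
`Z n j = ⟨e j, S N ΔW_n⟩` is the noise. Up to a constant of polynomial size in `N`, the drift `g` is
`h a_q y ^ q` with an error of at most half of this term (`abs_eulerMap_sub_le`).

*One step.* A functional `A` of the state satisfies `A' ≥ κ A ^ 2` as soon as `A` exceeds a threshold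
which is polynomial in `N`; here `κ⁻¹` is polynomial in `N` too. The functional depends on the case.
* `q` even: `A = |c 0|`, since `∫ y ^ q ≥ |∫ y| ^ q` (`le_abs_coeff_zero_of_even`).
* `q` odd, linear-implicit Euler: `A` is the `L²`-norm. Testing `S⁻¹ Y_{n+1}` with `Y_n` produces
  `∫ y ^ (q + 1)`, and `S⁻¹` costs only a factor `O(N)` on the range of `P N`
  (`le_mul_coeffNorm_of_odd`).
* `q` odd, exponential Euler: now `S⁻¹` may be exponentially large and this test fails. Instead, the
  kernel of `P N S` is a truncation of the heat kernel, which is nonnegative by Jacobi's theta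
  transformation, and the truncation error tends to `0` (`neg_heatTail_le_sum`). Hence the cone of
  functions that, up to a sign, are bounded below by minus a quarter of their mean value is preserved,
  and in this cone `A = |c 0|` works (`exists_sign_of_odd_exp`).

Iterating, `A` reaches at least `2 ^ 2 ^ (N - 1)` after `N` steps (`two_pow_two_pow_le_coeffNorm`),
provided that `Z 0 0` is at least some `M` polynomial in `N` and that all other `Z n j` are bounded.
The increments of `W` are independent and the modes of one increment are independent centred normal
variables (`map_inner_increment`), so this event has probability at least `exp (-poly(N))`
(`le_measure_kickEvent`). The doubly exponential growth wins (`tendsto_gaussianPDF_mul_two_pow`).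
-/

namespace EulerSPDE

/-! ### Trigonometric polynomials -/

instance isProbabilityMeasure_lam : IsProbabilityMeasure lam := ⟨by simp [lam]⟩

lemma integrable_lam {f : ℝ → ℝ} (hf : Continuous f) : Integrable f lam :=
  (hf.integrableOn_Icc (a := 0) (b := 1)).mono_set Set.Ioo_subset_Icc_self

lemma abs_trigFun_le (n : ℤ) (x : ℝ) : |trigFun n x| ≤ 2 := by
  have h2 : √2 ≤ 2 := by
    rw [Real.sqrt_le_left (by norm_num)]
    norm_num
  have h0 : 0 ≤ √2 := Real.sqrt_nonneg 2
  unfold trigFun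
  split_ifs
  · norm_num
  · rw [abs_mul, abs_of_nonneg h0]
    nlinarith [Real.abs_cos_le_one (2 * n * Real.pi * x), abs_nonneg (Real.cos (2 * n * Real.pi * x))]
  · rw [abs_mul, abs_of_nonneg h0]
    nlinarith [Real.abs_sin_le_one (2 * (-n : ℤ) * Real.pi * x),
      abs_nonneg (Real.sin (2 * (-n : ℤ) * Real.pi * x))]

@[simp] lemma trigFun_zero (x : ℝ) : trigFun 0 x = 1 := by simp [trigFun]

lemma integral_trigFun_mul_trigFun (m n : ℤ) :
    ∫ x, trigFun m x * trigFun n x ∂lam = if m = n then 1 else 0 := by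
  have h := orthonormal_iff_ite.1 orthonormal_e m n
  rw [inner_e, intervalIntegral.integral_of_le zero_le_one, integral_Ioc_eq_integral_Ioo] at h
  exact h

/-- The trigonometric polynomial with coefficients `c n`, `-N ≤ n ≤ N`. -/
noncomputable def trigPoly (N : ℕ) (c : ℤ → ℝ) (x : ℝ) : ℝ :=
  ∑ n ∈ Finset.Icc (-(N : ℤ)) N, c n * trigFun n x

lemma continuous_trigPoly (N : ℕ) (c : ℤ → ℝ) : Continuous (trigPoly N c) := by
  unfold trigPoly
  exact continuous_finsetSum _ fun n _ => (continuous_trigFun n).const_mul _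

lemma zero_mem_Icc_neg (N : ℕ) : (0 : ℤ) ∈ Finset.Icc (-(N : ℤ)) N := by
  simp

lemma card_Icc_neg (N : ℕ) : ((Finset.Icc (-(N : ℤ)) N).card : ℝ) = 2 * N + 1 := by
  rw [Int.card_Icc]
  have : ((N : ℤ) + 1 - -(N : ℤ)).toNat = 2 * N + 1 := by omega
  rw [this]
  push_cast
  ring

lemma integral_trigFun_mul_trigPoly {N : ℕ} (c : ℤ → ℝ) {m : ℤ}
    (hm : m ∈ Finset.Icc (-(N : ℤ)) N) : ∫ x, trigFun m x * trigPoly N c x ∂lam = c m := by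
  unfold trigPoly
  simp_rw [Finset.mul_sum]
  rw [integral_finsetSum]
  · have : ∀ n, ∫ x, trigFun m x * (c n * trigFun n x) ∂lam = c n * if m = n then 1 else 0 := by
      intro n
      rw [← integral_trigFun_mul_trigFun, ← integral_const_mul]
      congr 1
      ext x
      ring
    simp_rw [this]
    simp only [mul_ite, mul_one, mul_zero, Finset.sum_ite_eq, if_pos hm]
  · intro n _
    exact integrable_lam ((continuous_trigFun m).mul ((continuous_trigFun n).const_mul _))

lemma integral_trigPoly (N : ℕ) (c : ℤ → ℝ) : ∫ x, trigPoly N c x ∂lam = c 0 := by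
  simpa using integral_trigFun_mul_trigPoly c (zero_mem_Icc_neg N)

lemma sum_mul_integral_trigFun_mul {N : ℕ} (c : ℤ → ℝ) {v : ℝ → ℝ} (hv : Continuous v) :
    ∑ n ∈ Finset.Icc (-(N : ℤ)) N, c n * ∫ x, trigFun n x * v x ∂lam
      = ∫ x, trigPoly N c x * v x ∂lam := by
  simp_rw [← integral_const_mul]
  rw [← integral_finsetSum]
  · congr 1
    ext x
    rw [trigPoly, Finset.sum_mul]
    exact Finset.sum_congr rfl fun n _ => by ring
  · intro n _
    exact integrable_lam (((continuous_trigFun n).mul hv).const_mul _)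

lemma integral_trigPoly_sq (N : ℕ) (c : ℤ → ℝ) :
    ∫ x, trigPoly N c x ^ 2 ∂lam = ∑ n ∈ Finset.Icc (-(N : ℤ)) N, c n ^ 2 := by
  simp_rw [sq]
  rw [← sum_mul_integral_trigFun_mul c (continuous_trigPoly N c)]
  exact Finset.sum_congr rfl fun n hn => by rw [integral_trigFun_mul_trigPoly c hn]

lemma abs_trigPoly_le {N : ℕ} {c : ℤ → ℝ} {C : ℝ}
    (hc : ∀ n ∈ Finset.Icc (-(N : ℤ)) N, |c n| ≤ C) (x : ℝ) :
    |trigPoly N c x| ≤ (2 * N + 1) * (C * 2) := by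
  refine (Finset.abs_sum_le_sum_abs _ _).trans ?_
  rw [← card_Icc_neg, ← nsmul_eq_mul]
  refine Finset.sum_le_card_nsmul _ _ _ fun n hn => ?_
  rw [abs_mul]
  exact mul_le_mul (hc n hn) (abs_trigFun_le n x) (abs_nonneg _) ((abs_nonneg _).trans (hc n hn))

lemma abs_integral_trigFun_mul_le {v : ℝ → ℝ} (hv : Continuous v) {G : ℝ} (hG : ∀ x, |v x| ≤ G)
    (n : ℤ) : |∫ x, trigFun n x * v x ∂lam| ≤ 2 * G := by
  refine abs_integral_le_integral_abs.trans ?_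
  calc ∫ x, |trigFun n x * v x| ∂lam ≤ ∫ _, 2 * G ∂lam := by
        refine integral_mono (integrable_lam (by have := continuous_trigFun n; fun_prop))
          (integrable_const _) fun x => ?_
        simp only [abs_mul]
        exact mul_le_mul (abs_trigFun_le n x) (hG x) (abs_nonneg _) zero_le_two
    _ = 2 * G := by simp

lemma pow_integral_le_integral_pow {u : ℝ → ℝ} (hu : Continuous u) (h0 : ∀ x, 0 ≤ u x) (k : ℕ) :
    (∫ x, u x ∂lam) ^ k ≤ ∫ x, u x ^ k ∂lam :=
  (convexOn_pow k).map_integral_le (by fun_prop) isClosed_Ici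
    (Eventually.of_forall fun x => h0 x) (integrable_lam hu) (integrable_lam (hu.pow k))

lemma even_pow_integral_le_integral_pow {u : ℝ → ℝ} (hu : Continuous u) {k : ℕ} (hk : Even k) :
    (∫ x, u x ∂lam) ^ k ≤ ∫ x, u x ^ k ∂lam :=
  hk.convexOn_pow.map_integral_le (by fun_prop) isClosed_univ
    (Eventually.of_forall fun x => Set.mem_univ _) (integrable_lam hu) (integrable_lam (hu.pow k))

/-! ### The truncated heat kernel -/

lemma summable_exp_neg_mul_int_sq {t : ℝ} (ht : 0 < t) :
    Summable fun n : ℤ => Real.exp (t * (-4 * Real.pi ^ 2 * (n : ℝ) ^ 2)) := by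
  have h1 : Summable fun n : ℕ => Real.exp (t * (-4 * Real.pi ^ 2 * (n : ℝ) ^ 2)) := by
    have hc : -(t * (4 * Real.pi ^ 2)) < 0 := by
      have := Real.pi_pos
      have : 0 < t * (4 * Real.pi ^ 2) := by positivity
      linarith
    refine Summable.of_nonneg_of_le (fun n => (Real.exp_pos _).le) (fun n => ?_)
      (Real.summable_exp_nat_mul_iff.2 hc)
    rw [Real.exp_le_exp]
    have hn : (n : ℝ) ≤ (n : ℝ) ^ 2 := by
      exact_mod_cast Nat.le_self_pow two_ne_zero n
    nlinarith
  refine Summable.of_nat_of_neg ?_ ?_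
  · simpa using h1
  · simpa using h1

/-- The heat kernel on the circle is nonnegative, by Jacobi's transformation formula. -/
lemma tsum_exp_mul_cos_nonneg {t : ℝ} (ht : 0 < t) (x : ℝ) :
    0 ≤ ∑' n : ℤ, Real.exp (t * (-4 * Real.pi ^ 2 * (n : ℝ) ^ 2)) *
      Real.cos (2 * n * Real.pi * x) := by
  have hpi := Real.pi_pos
  obtain ⟨a, ha⟩ : ∃ a : ℝ, a = 4 * Real.pi * t := ⟨_, rfl⟩
  have ha0 : 0 < a := by rw [ha]; positivity
  have key := Complex.tsum_exp_neg_quadratic (a := (a : ℂ)) (by simpa using ha0) (Complex.I * x)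
  have hterm : ∀ n : ℤ, (Complex.exp (-Real.pi * a * n ^ 2 + 2 * Real.pi * (Complex.I * x) * n)).re
      = Real.exp (t * (-4 * Real.pi ^ 2 * (n : ℝ) ^ 2)) * Real.cos (2 * n * Real.pi * x) := by
    intro n
    have : (-Real.pi * a * n ^ 2 + 2 * Real.pi * (Complex.I * x) * n : ℂ)
        = ((t * (-4 * Real.pi ^ 2 * (n : ℝ) ^ 2) : ℝ) : ℂ)
          + ((2 * n * Real.pi * x : ℝ) : ℂ) * Complex.I := by
      rw [ha]
      push_cast
      ring
    rw [this, Complex.exp_add, ← Complex.ofReal_exp, Complex.re_ofReal_mul,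
      Complex.exp_ofReal_mul_I_re]
  have hnorm : ∀ n : ℤ, ‖Complex.exp (-Real.pi * a * n ^ 2 + 2 * Real.pi * (Complex.I * x) * n)‖
      = Real.exp (t * (-4 * Real.pi ^ 2 * (n : ℝ) ^ 2)) := by
    intro n
    rw [Complex.norm_exp]
    congr 1
    have : (-Real.pi * a * n ^ 2 + 2 * Real.pi * (Complex.I * x) * n : ℂ)
        = ((t * (-4 * Real.pi ^ 2 * (n : ℝ) ^ 2) : ℝ) : ℂ)
          + ((2 * n * Real.pi * x : ℝ) : ℂ) * Complex.I := by
      rw [ha]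
      push_cast
      ring
    rw [this]
    simp only [Complex.add_re, Complex.ofReal_re, Complex.re_ofReal_mul, Complex.I_re]
    ring
  have hsum : Summable fun n : ℤ =>
      Complex.exp (-Real.pi * a * n ^ 2 + 2 * Real.pi * (Complex.I * x) * n) := by
    refine Summable.of_norm ?_
    simp_rw [hnorm]
    exact summable_exp_neg_mul_int_sq ht
  have hrhs : (1 / (a : ℂ) ^ (1 / 2 : ℂ) * ∑' n : ℤ,
      Complex.exp (-Real.pi / a * (n + Complex.I * (Complex.I * x)) ^ 2))
      = ((1 / a ^ (1 / 2 : ℝ) * ∑' n : ℤ, Real.exp (-Real.pi / a * (n - x) ^ 2) : ℝ) : ℂ) := by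
    rw [Complex.ofReal_mul, Complex.ofReal_tsum]
    congr 1
    · rw [Complex.ofReal_div, Complex.ofReal_cpow ha0.le]
      norm_num
    · refine tsum_congr fun n => ?_
      rw [Complex.ofReal_exp]
      congr 1
      push_cast
      rw [← mul_assoc, Complex.I_mul_I]
      ring
  rw [hrhs] at key
  have hre := congrArg Complex.re key
  rw [Complex.ofReal_re, Complex.re_tsum hsum] at hre
  simp_rw [hterm] at hre
  rw [hre]
  refine mul_nonneg (by positivity) (tsum_nonneg fun n => (Real.exp_pos _).le)

lemma sum_Icc_neg_symm {N : ℕ} (F : ℤ → ℝ) :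
    ∑ n ∈ Finset.Icc (-(N : ℤ)) N, F n
      = ∑ n ∈ Finset.Icc (-(N : ℤ)) N, (F n + F (-n)) / 2 := by
  have h : ∑ n ∈ Finset.Icc (-(N : ℤ)) N, F (-n) = ∑ n ∈ Finset.Icc (-(N : ℤ)) N, F n := by
    refine Finset.sum_equiv (Equiv.neg ℤ) (fun i => ?_) (fun i _ => rfl)
    simp only [Finset.mem_Icc, Equiv.neg_apply]
    omega
  rw [← Finset.sum_div, Finset.sum_add_distrib, h]
  ring

lemma trigFun_mul_add_trigFun_neg_mul (n : ℤ) (x z : ℝ) :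
    (trigFun n x * trigFun n z + trigFun (-n) x * trigFun (-n) z) / 2
      = Real.cos (2 * n * Real.pi * (x - z)) := by
  have h2 : √2 * √2 = (2 : ℝ) := Real.mul_self_sqrt (by norm_num)
  rw [show 2 * (n : ℝ) * Real.pi * (x - z) = 2 * n * Real.pi * x - 2 * n * Real.pi * z by ring,
    Real.cos_sub]
  rcases lt_trichotomy n 0 with hn | rfl | hn
  · have h1 : 0 < -n := by omega
    simp only [trigFun, hn.ne, hn.not_gt, h1, h1.ne', if_true, if_false]
    push_cast
    rw [show ∀ y : ℝ, 2 * -(n : ℝ) * Real.pi * y = -(2 * n * Real.pi * y) by intro y; ring]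
    rw [show ∀ y : ℝ, 2 * -(n : ℝ) * Real.pi * y = -(2 * n * Real.pi * y) by intro y; ring]
    simp only [Real.sin_neg, Real.cos_neg]
    linear_combination ((Real.cos (2 * n * Real.pi * x) * Real.cos (2 * n * Real.pi * z)
      + Real.sin (2 * n * Real.pi * x) * Real.sin (2 * n * Real.pi * z)) / 2) * h2
  · simp
  · have h1 : ¬ 0 < -n := by omega
    have h3 : -n ≠ 0 := by omega
    simp only [trigFun, hn.ne', hn, h1, h3, if_true, if_false, neg_neg]
    linear_combination ((Real.cos (2 * n * Real.pi * x) * Real.cos (2 * n * Real.pi * z)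
      + Real.sin (2 * n * Real.pi * x) * Real.sin (2 * n * Real.pi * z)) / 2) * h2

/-- The tail which bounds the negative part of the truncated heat kernel. For `|n| > N` one has
`n ^ 2 / N ≥ |n|`, which makes it the tail of a series that does not depend on `N`. -/
noncomputable def heatTail (T : ℝ) (N : ℕ) : ℝ :=
  ∑' n : {n : ℤ // n ∉ Finset.Icc (-(N : ℤ)) N}, Real.exp (-(4 * Real.pi ^ 2 * T) * |(n : ℤ)|)

lemma summable_exp_neg_mul_abs {c : ℝ} (hc : 0 < c) :
    Summable fun n : ℤ => Real.exp (-c * |n|) := by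
  have h1 : Summable fun n : ℕ => Real.exp (n * -c) :=
    Real.summable_exp_nat_mul_iff.2 (by linarith)
  refine Summable.of_nat_of_neg ?_ ?_ <;>
  · refine h1.congr fun n => ?_
    simp [mul_comm]

lemma tendsto_heatTail (T : ℝ) : Tendsto (heatTail T) atTop (𝓝 0) := by
  have h1 := tendsto_tsum_compl_atTop_zero
    (fun n : ℤ => Real.exp (-(4 * Real.pi ^ 2 * T) * |n|))
  refine h1.comp (tendsto_atTop_finset_of_monotone ?_ ?_)
  · intro m n hmn
    apply Finset.Icc_subset_Icc <;> simpa using hmn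
  · intro n
    refine ⟨n.natAbs, ?_⟩
    simp only [Finset.mem_Icc]
    omega

/-- The kernel of `P_N e^{(T/N)A}` is bounded below by `-heatTail T N`. -/
lemma neg_heatTail_le_sum {T : ℝ} (hT : 0 < T) {N : ℕ} (hN : 1 ≤ N) (x z : ℝ) :
    -heatTail T N ≤ ∑ n ∈ Finset.Icc (-(N : ℤ)) N,
      Real.exp (T / N * (-4 * Real.pi ^ 2 * (n : ℝ) ^ 2)) * (trigFun n x * trigFun n z) := by
  have hN0 : (0 : ℝ) < N := by exact_mod_cast hN
  have ht : 0 < T / N := by positivity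
  set s : ℤ → ℝ := fun n => Real.exp (T / N * (-4 * Real.pi ^ 2 * (n : ℝ) ^ 2)) with hs
  set F : ℤ → ℝ := fun n => s n * Real.cos (2 * n * Real.pi * (x - z)) with hF
  have hsumm : Summable F := by
    refine Summable.of_norm_bounded (summable_exp_neg_mul_int_sq ht) fun n => ?_
    rw [Real.norm_eq_abs, abs_mul, abs_of_pos (Real.exp_pos _)]
    exact mul_le_of_le_one_right (Real.exp_pos _).le (Real.abs_cos_le_one _)
  have h1 : ∑ n ∈ Finset.Icc (-(N : ℤ)) N, s n * (trigFun n x * trigFun n z)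
      = ∑ n ∈ Finset.Icc (-(N : ℤ)) N, F n := by
    rw [sum_Icc_neg_symm]
    refine Finset.sum_congr rfl fun n _ => ?_
    have : s (-n) = s n := by simp [hs]
    rw [this, hF]
    simp only
    rw [← trigFun_mul_add_trigFun_neg_mul]
    ring
  have h2 : 0 ≤ ∑' n, F n := tsum_exp_mul_cos_nonneg ht (x - z)
  have hc : 0 < 4 * Real.pi ^ 2 * T := by
    have := Real.pi_pos
    positivity
  have h3 : ∑' n : {n : ℤ // n ∉ Finset.Icc (-(N : ℤ)) N}, F n ≤ heatTail T N := by
    refine Summable.tsum_le_tsum (fun n => ?_) (hsumm.subtype _)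
      ((summable_exp_neg_mul_abs hc).subtype _)
    refine (le_abs_self _).trans ?_
    rw [hF]
    simp only
    rw [abs_mul, abs_of_pos (Real.exp_pos _)]
    refine (mul_le_of_le_one_right (Real.exp_pos _).le (Real.abs_cos_le_one _)).trans ?_
    rw [Real.exp_le_exp]
    have hn : (N : ℝ) ≤ |((n : ℤ) : ℝ)| := by
      have := n.2
      rw [Finset.mem_Icc] at this
      have h4 : (N : ℤ) ≤ |(n : ℤ)| := by
        by_contra hcon
        rw [not_le, abs_lt] at hcon
        omega
      exact_mod_cast h4
    have h5 : |((n : ℤ) : ℝ)| ≤ ((n : ℤ) : ℝ) ^ 2 / N := by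
      rw [le_div_iff₀ hN0, ← sq_abs, sq]
      exact mul_le_mul_of_nonneg_left hn (abs_nonneg _)
    have h6 : T / N * (-4 * Real.pi ^ 2 * ((n : ℤ) : ℝ) ^ 2)
        = -(4 * Real.pi ^ 2 * T) * (((n : ℤ) : ℝ) ^ 2 / N) := by ring
    rw [h6]
    push_cast
    nlinarith
  have h4 := hsumm.sum_add_tsum_subtype_compl (Finset.Icc (-(N : ℤ)) N)
  rw [h1]
  linarith

/-! ### One step of the scheme -/

lemma exists_sign_mul_eq_abs (β : ℝ) : ∃ σ : ℝ, (σ = 1 ∨ σ = -1) ∧ σ * β = |β| := by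
  rcases le_total 0 β with h | h
  · exact ⟨1, Or.inl rfl, by rw [one_mul, abs_of_nonneg h]⟩
  · exact ⟨-1, Or.inr rfl, by rw [neg_one_mul, abs_of_nonpos h]⟩

lemma abs_sign {σ : ℝ} (hσ : σ = 1 ∨ σ = -1) : |σ| = 1 := by
  rcases hσ with rfl | rfl <;> simp

/-- For even degree the mean value alone grows superlinearly, by Jensen's inequality. -/
lemma le_abs_coeff_zero_of_even {N q : ℕ} (hq : Even q) {g : ℝ → ℝ} (hg : Continuous g)
    {β D B : ℝ} (hgβ : ∀ y, |g y - β * y ^ q| ≤ |β| / 2 * |y| ^ q + D) {c : ℤ → ℝ} {w z : ℝ}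
    (hw : w = ∫ x, g (trigPoly N c x) ∂lam + z) (hz : |z| ≤ B) :
    |β| / 2 * |c 0| ^ q - D - B ≤ |w| := by
  obtain ⟨σ, hσ, hσβ⟩ := exists_sign_mul_eq_abs β
  have hy := continuous_trigPoly N c
  have h1 : ∀ y, |β| / 2 * y ^ q - D ≤ σ * g y := by
    intro y
    have h2 : |σ * (g y - β * y ^ q)| ≤ |β| / 2 * |y| ^ q + D := by
      rw [abs_mul, abs_sign hσ, one_mul]
      exact hgβ y
    rw [mul_sub, ← mul_assoc, hσβ, hq.pow_abs] at h2
    have h3 := (abs_le.1 h2).1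
    linarith
  have h2 : |β| / 2 * |c 0| ^ q - D ≤ σ * ∫ x, g (trigPoly N c x) ∂lam := by
    calc |β| / 2 * |c 0| ^ q - D
        ≤ |β| / 2 * ∫ x, trigPoly N c x ^ q ∂lam - D := by
          have := even_pow_integral_le_integral_pow hy hq
          rw [integral_trigPoly] at this
          rw [hq.pow_abs]
          have h0 : 0 ≤ |β| / 2 := by positivity
          nlinarith
      _ = ∫ x, (|β| / 2 * trigPoly N c x ^ q - D) ∂lam := by
          rw [integral_sub (integrable_lam (by fun_prop)) (integrable_const _), integral_const_mul]
          simp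
      _ ≤ ∫ x, σ * g (trigPoly N c x) ∂lam :=
          integral_mono (integrable_lam (by fun_prop)) (integrable_lam (by fun_prop))
            fun x => h1 _
      _ = σ * ∫ x, g (trigPoly N c x) ∂lam := integral_const_mul _ _
  have h3 : |σ * w| = |w| := by rw [abs_mul, abs_sign hσ, one_mul]
  have h4 : |σ * z| ≤ B := by rwa [abs_mul, abs_sign hσ, one_mul]
  rw [← h3, hw, mul_add]
  have h5 := (abs_le.1 h4).1
  refine le_trans ?_ (le_abs_self _)
  linarith

/-- The `ℓ²`-norm of the coefficients with `|n| ≤ N`. -/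
noncomputable def coeffNorm (N : ℕ) (c : ℤ → ℝ) : ℝ := √(∑ n ∈ Finset.Icc (-(N : ℤ)) N, c n ^ 2)

lemma coeffNorm_nonneg (N : ℕ) (c : ℤ → ℝ) : 0 ≤ coeffNorm N c := Real.sqrt_nonneg _

lemma coeffNorm_sq (N : ℕ) (c : ℤ → ℝ) :
    coeffNorm N c ^ 2 = ∑ n ∈ Finset.Icc (-(N : ℤ)) N, c n ^ 2 :=
  Real.sq_sqrt (Finset.sum_nonneg fun _ _ => sq_nonneg _)

lemma abs_le_coeffNorm {N : ℕ} (c : ℤ → ℝ) {n : ℤ} (hn : n ∈ Finset.Icc (-(N : ℤ)) N) :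
    |c n| ≤ coeffNorm N c := by
  rw [← Real.sqrt_sq_eq_abs]
  exact Real.sqrt_le_sqrt (Finset.single_le_sum (f := fun n => c n ^ 2)
    (fun _ _ => sq_nonneg _) hn)

/-- For odd degree and multipliers that decay at most polynomially, the `L²`-norm grows
superlinearly; this follows by testing with the current state. -/
lemma le_mul_coeffNorm_of_odd {N q : ℕ} (hq : Odd q) {g : ℝ → ℝ} (hg : Continuous g)
    {β D B L : ℝ} (hD : 0 ≤ D) (hL : 0 ≤ L)
    (hgβ : ∀ y, |g y - β * y ^ q| ≤ |β| / 2 * |y| ^ q + D)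
    {s c c' z : ℤ → ℝ} (hs0 : ∀ n, 0 < s n) (hs : ∀ n ∈ Finset.Icc (-(N : ℤ)) N, 1 ≤ L * s n)
    (hc' : ∀ n ∈ Finset.Icc (-(N : ℤ)) N,
      c' n = s n * ∫ x, trigFun n x * g (trigPoly N c x) ∂lam + z n)
    (hz : ∀ n ∈ Finset.Icc (-(N : ℤ)) N, |z n| ≤ B) :
    |β| / 2 * coeffNorm N c ^ (q + 1) - D * (1 + coeffNorm N c ^ 2)
      - (2 * N + 1) * (L * B) * coeffNorm N c ≤ L * coeffNorm N c' * coeffNorm N c := by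
  obtain ⟨σ, hσ, hσβ⟩ := exists_sign_mul_eq_abs β
  obtain ⟨k, hk⟩ : Even (q + 1) := hq.add_one
  have hy := continuous_trigPoly N c
  set y := trigPoly N c with hydef
  set A := coeffNorm N c with hA
  have hsL : ∀ n ∈ Finset.Icc (-(N : ℤ)) N, (s n)⁻¹ ≤ L := by
    intro n hn
    rw [inv_le_iff_one_le_mul₀ (hs0 n)]
    exact hs n hn
  have h1 : ∀ y : ℝ, |β| / 2 * (y ^ 2) ^ k - D * (1 + y ^ 2) ≤ σ * (y * g y) := by
    intro y
    have h2 : |σ * (g y - β * y ^ q)| ≤ |β| / 2 * |y| ^ q + D := by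
      rw [abs_mul, abs_sign hσ, one_mul]
      exact hgβ y
    rw [mul_sub, ← mul_assoc, hσβ] at h2
    have h3 : |y * (σ * g y - |β| * y ^ q)| ≤ |y| * (|β| / 2 * |y| ^ q + D) := by
      rw [abs_mul]
      exact mul_le_mul_of_nonneg_left h2 (abs_nonneg _)
    have h4 := (abs_le.1 h3).1
    have h5 : |y| * |y| ^ q = (y ^ 2) ^ k := by
      rw [← pow_succ', hk, ← two_mul, pow_mul, sq_abs]
    have h6 : y * y ^ q = (y ^ 2) ^ k := by
      rw [← pow_succ', hk, ← two_mul, pow_mul]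
    have h7 : |y| ≤ 1 + y ^ 2 := by
      rw [← sq_abs]
      nlinarith [sq_nonneg (|y| - 1), abs_nonneg y]
    have h8 : |y| * (|β| / 2 * |y| ^ q + D) = |β| / 2 * (y ^ 2) ^ k + D * |y| := by
      rw [← h5]
      ring
    have h9 : y * (σ * g y - |β| * y ^ q) = σ * (y * g y) - |β| * (y ^ 2) ^ k := by
      rw [← h6]
      ring
    rw [h8, h9] at h4
    nlinarith
  have hA2 : ∫ x, y x ^ 2 ∂lam = A ^ 2 := by
    rw [hA, coeffNorm_sq, hydef, integral_trigPoly_sq]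
  have h2 : |β| / 2 * A ^ (q + 1) - D * (1 + A ^ 2) ≤ σ * ∫ x, y x * g (y x) ∂lam := by
    calc |β| / 2 * A ^ (q + 1) - D * (1 + A ^ 2)
        ≤ |β| / 2 * ∫ x, (y x ^ 2) ^ k ∂lam - D * (1 + A ^ 2) := by
          have h3 := pow_integral_le_integral_pow (u := fun x => y x ^ 2) (by fun_prop)
            (fun x => sq_nonneg (y x)) k
          rw [hA2] at h3
          have h4 : A ^ (q + 1) = (A ^ 2) ^ k := by rw [hk, ← two_mul, pow_mul]
          rw [h4]
          have h0 : 0 ≤ |β| / 2 := by positivity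
          nlinarith
      _ = ∫ x, (|β| / 2 * (y x ^ 2) ^ k - D * (1 + y x ^ 2)) ∂lam := by
          rw [integral_sub (integrable_lam (by fun_prop)) (integrable_lam (by fun_prop)),
            integral_const_mul, integral_const_mul,
            integral_add (integrable_const _) (integrable_lam (by fun_prop)), hA2]
          simp
      _ ≤ ∫ x, σ * (y x * g (y x)) ∂lam :=
          integral_mono (integrable_lam (by fun_prop)) (integrable_lam (by fun_prop))
            fun x => h1 _
      _ = σ * ∫ x, y x * g (y x) ∂lam := integral_const_mul _ _
  have h3 : ∫ x, y x * g (y x) ∂lam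
      = ∑ n ∈ Finset.Icc (-(N : ℤ)) N, (c' n * (s n)⁻¹ * c n - z n * (s n)⁻¹ * c n) := by
    rw [hydef, ← sum_mul_integral_trigFun_mul c (v := fun x => g (trigPoly N c x)) (hg.comp hy)]
    refine Finset.sum_congr rfl fun n hn => ?_
    rw [hc' n hn]
    have := (hs0 n).ne'
    field_simp
    ring
  have h4 : |∑ n ∈ Finset.Icc (-(N : ℤ)) N, c' n * (s n)⁻¹ * c n| ≤ L * coeffNorm N c' * A := by
    calc |∑ n ∈ Finset.Icc (-(N : ℤ)) N, c' n * (s n)⁻¹ * c n|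
        ≤ ∑ n ∈ Finset.Icc (-(N : ℤ)) N, |c' n * (s n)⁻¹ * c n| := Finset.abs_sum_le_sum_abs _ _
      _ ≤ ∑ n ∈ Finset.Icc (-(N : ℤ)) N, L * (|c' n| * |c n|) := by
          refine Finset.sum_le_sum fun n hn => ?_
          rw [abs_mul, abs_mul, abs_of_pos (inv_pos.2 (hs0 n))]
          have := mul_le_mul_of_nonneg_left (hsL n hn)
            (mul_nonneg (abs_nonneg (c' n)) (abs_nonneg (c n)))
          linarith
      _ = L * ∑ n ∈ Finset.Icc (-(N : ℤ)) N, |c' n| * |c n| := by rw [Finset.mul_sum]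
      _ ≤ L * (coeffNorm N c' * A) := by
          refine mul_le_mul_of_nonneg_left ?_ hL
          have := Real.sum_mul_le_sqrt_mul_sqrt (Finset.Icc (-(N : ℤ)) N)
            (fun n => |c' n|) (fun n => |c n|)
          simp only [sq_abs] at this
          exact this
      _ = L * coeffNorm N c' * A := by ring
  have h5 : |∑ n ∈ Finset.Icc (-(N : ℤ)) N, z n * (s n)⁻¹ * c n| ≤ (2 * N + 1) * (L * B) * A := by
    refine (Finset.abs_sum_le_sum_abs _ _).trans ?_
    rw [mul_assoc, ← card_Icc_neg, ← nsmul_eq_mul]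
    refine Finset.sum_le_card_nsmul _ _ _ fun n hn => ?_
    rw [abs_mul, abs_mul, abs_of_pos (inv_pos.2 (hs0 n)), mul_comm L B]
    have hB : 0 ≤ B := (abs_nonneg _).trans (hz n hn)
    exact mul_le_mul (mul_le_mul (hz n hn) (hsL n hn) (inv_pos.2 (hs0 n)).le hB)
      (abs_le_coeffNorm c hn) (abs_nonneg _) (mul_nonneg hB hL)
  rw [h3, Finset.sum_sub_distrib] at h2
  have h6 := le_abs_self (σ * (∑ n ∈ Finset.Icc (-(N : ℤ)) N, c' n * (s n)⁻¹ * c n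
    - ∑ n ∈ Finset.Icc (-(N : ℤ)) N, z n * (s n)⁻¹ * c n))
  rw [abs_mul, abs_sign hσ, one_mul] at h6
  have h7 := abs_sub (∑ n ∈ Finset.Icc (-(N : ℤ)) N, c' n * (s n)⁻¹ * c n)
    (∑ n ∈ Finset.Icc (-(N : ℤ)) N, z n * (s n)⁻¹ * c n)
  linarith

/-- For odd degree and the heat semigroup, the truncated heat kernel is nearly nonnegative, and
so the scheme stays in the cone of functions whose negative part is at most a quarter of their
mean value. In this cone the mean value grows superlinearly. -/
lemma exists_sign_of_odd_exp {T : ℝ} (hT : 0 < T) {N q : ℕ} (hN : 1 ≤ N)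
    (hε : heatTail T N ≤ 1 / 8) (hq : Odd q) (hq3 : 3 ≤ q) {g : ℝ → ℝ} (hg : Continuous g)
    {β D B : ℝ} (hD : 0 ≤ D)
    (hgβ : ∀ y, |g y - β * y ^ q| ≤ |β| / 2 * |y| ^ q + D) {c c' z : ℤ → ℝ}
    (hc' : ∀ n ∈ Finset.Icc (-(N : ℤ)) N, c' n = Real.exp (T / N * (-4 * Real.pi ^ 2 * (n : ℝ) ^ 2))
      * ∫ x, trigFun n x * g (trigPoly N c x) ∂lam + z n)
    (hz : ∀ n ∈ Finset.Icc (-(N : ℤ)) N, |z n| ≤ B) {σ : ℝ} (hσ : σ = 1 ∨ σ = -1)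
    (hm : 0 ≤ σ * c 0) (hcone : ∀ x, -(σ * c 0 / 4) ≤ σ * trigPoly N c x)
    (hlarge : 100 * (D + (2 * N + 1) * B) ≤ |β| * (σ * c 0) ^ q) :
    ∃ σ' : ℝ, (σ' = 1 ∨ σ' = -1) ∧ |β| / 4 * (σ * c 0) ^ q ≤ σ' * c' 0 ∧
      ∀ x, -(σ' * c' 0 / 4) ≤ σ' * trigPoly N c' x := by
  obtain ⟨τ, hτ, hτβ⟩ := exists_sign_mul_eq_abs β
  have hσq : σ ^ q = σ := by
    rcases hσ with rfl | rfl
    · simp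
    · exact hq.neg_one_pow
  have hστ : σ * τ = 1 ∨ σ * τ = -1 := by
    rcases hσ with rfl | rfl <;> rcases hτ with rfl | rfl <;> norm_num
  have hy := continuous_trigPoly N c
  have hmint : ∫ x, σ * trigPoly N c x ∂lam = σ * c 0 := by
    rw [integral_const_mul, integral_trigPoly]
  set m := σ * c 0 with hmdef
  set u : ℝ → ℝ := fun x => σ * trigPoly N c x with hu
  have hucont : Continuous u := by fun_prop
  set v : ℝ → ℝ := fun x => σ * τ * g (trigPoly N c x) with hv
  have hvcont : Continuous v := by fun_prop
  set d : ℝ := 3 * |β| / 2 * (m / 4) ^ q + D with hd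
  have hβ := abs_nonneg β
  have hd0 : 0 ≤ d := by positivity
  -- pointwise lower bound for the signed drift `v`; `d` bounds its negative part
  have hvlow : ∀ x, |β| / 2 * (max (u x) 0) ^ q - d ≤ v x := by
    intro x
    have h2 : |σ * τ * (g (trigPoly N c x) - β * trigPoly N c x ^ q)|
        ≤ |β| / 2 * |u x| ^ q + D := by
      rw [abs_mul, abs_sign hστ, one_mul, hu]
      simp only
      rw [abs_mul, abs_sign hσ, one_mul]
      exact hgβ _
    have h3 : σ * τ * (g (trigPoly N c x) - β * trigPoly N c x ^ q) = v x - |β| * u x ^ q := by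
      rw [hu, hv, ← hτβ]
      simp only
      rw [mul_pow, hσq]
      ring
    rw [h3] at h2
    have h4 := (abs_le.1 h2).1
    have hmq : 0 ≤ (m / 4) ^ q := by positivity
    rcases le_total 0 (u x) with h | h
    · rw [abs_of_nonneg h] at h4
      rw [max_eq_left h, hd]
      have : 0 ≤ 3 * |β| / 2 * (m / 4) ^ q := by positivity
      linarith
    · rw [max_eq_right h, zero_pow (by omega), hd]
      have h5 : |u x| ^ q ≤ (m / 4) ^ q := by
        refine pow_le_pow_left₀ (abs_nonneg _) ?_ q
        rw [abs_of_nonpos h]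
        have := hcone x
        linarith
      have h6 : -|u x| ^ q ≤ u x ^ q := by
        rw [← abs_pow]
        exact neg_abs_le _
      nlinarith
  have hvd : ∀ x, 0 ≤ v x + d := by
    intro x
    have := hvlow x
    have h2 : 0 ≤ |β| / 2 * (max (u x) 0) ^ q := by positivity
    linarith
  set I := ∫ x, v x ∂lam with hI
  have hIlow : |β| / 2 * m ^ q - d ≤ I := by
    calc |β| / 2 * m ^ q - d ≤ |β| / 2 * ∫ x, (max (u x) 0) ^ q ∂lam - d := by
          have h1 : m ≤ ∫ x, max (u x) 0 ∂lam := by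
            rw [← hmint]
            exact integral_mono (integrable_lam hucont)
              (integrable_lam (hucont.max continuous_const)) fun x => le_max_left _ _
          have h2 := pow_integral_le_integral_pow (hucont.max continuous_const)
            (fun x => le_max_right (u x) 0) q
          have h3 : m ^ q ≤ (∫ x, max (u x) 0 ∂lam) ^ q := pow_le_pow_left₀ hm h1 q
          nlinarith
      _ = ∫ x, (|β| / 2 * (max (u x) 0) ^ q - d) ∂lam := by
          rw [integral_sub (integrable_lam (by fun_prop)) (integrable_const _), integral_const_mul]
          simp
      _ ≤ I := integral_mono (integrable_lam (by fun_prop)) (integrable_lam hvcont) hvlow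
  -- `q ≥ 3` makes the negative part contract: `4 ^ q ≥ 64`
  have hdX : d ≤ 3 / 128 * (|β| * m ^ q) + D := by
    have h1 : (m / 4) ^ q ≤ m ^ q / 64 := by
      rw [div_pow]
      refine div_le_div_of_nonneg_left (by positivity) (by norm_num) ?_
      calc (64 : ℝ) = 4 ^ 3 := by norm_num
        _ ≤ 4 ^ q := pow_le_pow_right₀ (by norm_num) hq3
    rw [hd]
    nlinarith
  have hz0 : ∀ n ∈ Finset.Icc (-(N : ℤ)) N, |σ * τ * z n| ≤ B := by
    intro n hn
    rw [abs_mul, abs_sign hστ, one_mul]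
    exact hz n hn
  have hB : 0 ≤ B := (abs_nonneg _).trans (hz 0 (zero_mem_Icc_neg N))
  have hmean : σ * τ * c' 0 = I + σ * τ * z 0 := by
    rw [hc' 0 (zero_mem_Icc_neg N), hI, hv, integral_const_mul]
    simp
    ring
  have hNB : B ≤ (2 * N + 1) * B := by
    have : 0 ≤ (N : ℝ) * B := by positivity
    linarith
  have hmean2 : I - B ≤ σ * τ * c' 0 := by
    have := (abs_le.1 (hz0 0 (zero_mem_Icc_neg N))).1
    linarith
  refine ⟨σ * τ, hστ, ?_, ?_⟩
  · linarith
  · intro x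
    set K : ℝ → ℝ := trigPoly N fun n =>
      Real.exp (T / N * (-4 * Real.pi ^ 2 * (n : ℝ) ^ 2)) * trigFun n x with hK
    have hKcont : Continuous K := continuous_trigPoly N _
    have hKlow : ∀ y, -heatTail T N ≤ K y := by
      intro y
      refine (neg_heatTail_le_sum hT hN x y).trans (le_of_eq ?_)
      rw [hK, trigPoly]
      exact Finset.sum_congr rfl fun n _ => by ring
    have hKint : ∫ y, K y ∂lam = 1 := by
      rw [hK, integral_trigPoly]
      simp
    have hrep : σ * τ * trigPoly N c' x
        = ∫ y, K y * v y ∂lam + trigPoly N (fun n => σ * τ * z n) x := by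
      rw [hK, ← sum_mul_integral_trigFun_mul _ hvcont, trigPoly, trigPoly, Finset.mul_sum,
        ← Finset.sum_add_distrib]
      refine Finset.sum_congr rfl fun n hn => ?_
      have h1 : ∫ y, trigFun n y * v y ∂lam
          = σ * τ * ∫ y, trigFun n y * g (trigPoly N c y) ∂lam := by
        rw [← integral_const_mul]
        congr 1
        ext y
        rw [hv]
        ring
      rw [hc' n hn, h1]
      ring
    have hnoise := (abs_le.1 (abs_trigPoly_le hz0 x)).1
    -- `K` has integral `1`, so shifting `v` by `d` makes it nonnegative at the cost of `d`
    have hconv : -heatTail T N * (I + d) ≤ ∫ y, K y * v y ∂lam + d := by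
      calc -heatTail T N * (I + d) = ∫ y, -heatTail T N * (v y + d) ∂lam := by
            rw [integral_const_mul, integral_add (integrable_lam hvcont) (integrable_const _)]
            simp [hI]
        _ ≤ ∫ y, K y * (v y + d) ∂lam :=
            integral_mono (integrable_lam (by fun_prop)) (integrable_lam (by fun_prop))
              fun y => mul_le_mul_of_nonneg_right (hKlow y) (hvd y)
        _ = ∫ y, K y * v y ∂lam + d := by
            simp_rw [mul_add]
            rw [integral_add (integrable_lam (by fun_prop)) (integrable_lam (by fun_prop)),
              integral_mul_const, hKint, one_mul]
    have hId : 0 ≤ I + d := by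
      have : 0 ≤ |β| / 2 * m ^ q := by positivity
      linarith
    have h8 : heatTail T N * (I + d) ≤ 1 / 8 * (I + d) := mul_le_mul_of_nonneg_right hε hId
    rw [hrep]
    linarith

/-! ### Doubly exponential growth -/

/-- Iterating `A ↦ κ A²` from a value with `κ A ≥ 2` squares `κ A` in every step. -/
lemma exists_large_of_step {κ R : ℝ} {Good : ℕ → ℝ → Prop} {N : ℕ} (hN : 1 ≤ N) (hκ : 0 < κ)
    (hR : 0 < R) (hκR : 2 ≤ κ * R) (h1 : ∃ A, R ≤ A ∧ Good 1 A)
    (hstep : ∀ n, 1 ≤ n → n < N → ∀ A, R ≤ A → Good n A → ∃ A', κ * A ^ 2 ≤ A' ∧ Good (n + 1) A') :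
    ∃ A, (2 : ℝ) ^ 2 ^ (N - 1) ≤ κ * A ∧ Good N A := by
  have key : ∀ n, n + 1 ≤ N → ∃ A, R ≤ A ∧ (2 : ℝ) ^ 2 ^ n ≤ κ * A ∧ Good (n + 1) A := by
    intro n
    induction n with
    | zero =>
      intro _
      obtain ⟨A, hA, hg⟩ := h1
      exact ⟨A, hA, by simpa using hκR.trans (mul_le_mul_of_nonneg_left hA hκ.le), hg⟩
    | succ n ih =>
      intro hn
      obtain ⟨A, hA, hpow, hg⟩ := ih (by omega)
      obtain ⟨A', hA', hg'⟩ := hstep (n + 1) (by omega) (by omega) A hA hg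
      have h2 : 2 ≤ κ * A := hκR.trans (mul_le_mul_of_nonneg_left hA hκ.le)
      refine ⟨A', ?_, ?_, hg'⟩
      · nlinarith
      · calc (2 : ℝ) ^ 2 ^ (n + 1) = (2 ^ 2 ^ n) ^ 2 := by rw [← pow_mul, pow_succ]
          _ ≤ (κ * A) ^ 2 := pow_le_pow_left₀ (by positivity) hpow 2
          _ = κ * (κ * A ^ 2) := by ring
          _ ≤ κ * A' := mul_le_mul_of_nonneg_left hA' hκ.le
  obtain ⟨A, -, h2, h3⟩ := key (N - 1) (by omega)
  rw [Nat.sub_add_cancel hN] at h3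
  exact ⟨A, h2, h3⟩

lemma trigPoly_eq_coeff_zero_add (N : ℕ) (c : ℤ → ℝ) (x : ℝ) :
    trigPoly N c x = c 0 + trigPoly N (fun n => if n = 0 then 0 else c n) x := by
  have h : c 0 = ∑ n ∈ Finset.Icc (-(N : ℤ)) N, if n = 0 then c 0 else 0 := by
    rw [Finset.sum_ite_eq', if_pos (zero_mem_Icc_neg N)]
  rw [trigPoly, trigPoly, h, ← Finset.sum_add_distrib]
  refine Finset.sum_congr rfl fun n _ => ?_
  split_ifs with h0
  · subst h0
    simp
  · simp

/-- If the first noise increment has a large constant Fourier mode `Z 0 0` and all the other modes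
of the noise are bounded by `B`, then the scheme grows doubly exponentially. -/
lemma two_pow_two_pow_le_coeffNorm {T : ℝ} (hT : 0 < T) {N q : ℕ} (hN : 1 ≤ N) (hq : 2 ≤ q)
    {g : ℝ → ℝ} (hg : Continuous g) {β D B L R G : ℝ} (hβ : β ≠ 0) (hD : 0 ≤ D)
    (hL : 1 ≤ L) (hβL : |β| ≤ 4 * L)
    (hgβ : ∀ y, |g y - β * y ^ q| ≤ |β| / 2 * |y| ^ q + D)
    (hR : 1 ≤ R) (hR1 : 100 * (D + L * ((2 * N + 1) * B)) ≤ |β| * R) (hR2 : 8 * L ≤ |β| * R)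
    {s : ℤ → ℝ} (hs0 : s 0 = 1) (hspos : ∀ n, 0 < s n) (hs1 : ∀ n, s n ≤ 1)
    (hs : ((∀ n : ℤ, s n = Real.exp (T / N * (-4 * Real.pi ^ 2 * (n : ℝ) ^ 2)))
        ∧ heatTail T N ≤ 1 / 8) ∨ ∀ n ∈ Finset.Icc (-(N : ℤ)) N, 1 ≤ L * s n)
    {c Z : ℕ → ℤ → ℝ}
    (hc : ∀ n < N, ∀ j ∈ Finset.Icc (-(N : ℤ)) N,
      c (n + 1) j = s j * ∫ x, trigFun j x * g (trigPoly N (c n) x) ∂lam + Z n j)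
    (hG : ∀ x, |g (trigPoly N (c 0) x)| ≤ G)
    (hZ0 : 2 * G + R + (2 * N + 1) * ((2 * G + B) * 2) ≤ Z 0 0)
    (hZ : ∀ n < N, ∀ j ∈ Finset.Icc (-(N : ℤ)) N, ¬ (n = 0 ∧ j = 0) → |Z n j| ≤ B) :
    (2 : ℝ) ^ 2 ^ (N - 1) ≤ coeffNorm N (c N) := by
  have hβ0 : 0 < |β| := abs_pos.2 hβ
  have hL0 : 0 < L := by linarith
  have hN0 : (0 : ℝ) ≤ N := Nat.cast_nonneg N
  have hB : 0 ≤ B := by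
    refine (abs_nonneg _).trans (hZ 0 (by omega) 1 ?_ (by simp))
    simp only [Finset.mem_Icc]
    omega
  have hG0 : 0 ≤ G := (abs_nonneg _).trans (hG 0)
  set κ := |β| / (4 * L) with hκ
  have hκ0 : 0 < κ := by positivity
  have hκ1 : κ ≤ 1 := by
    rw [hκ, div_le_one (by positivity)]
    exact hβL
  have hκR : 2 ≤ κ * R := by
    rw [hκ, div_mul_eq_mul_div, le_div_iff₀ (by positivity)]
    linarith
  have hκ4 : κ ≤ |β| / 4 := by
    rw [hκ]
    exact div_le_div_of_nonneg_left hβ0.le (by norm_num) (by linarith)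
  have hBL : (2 * N + 1) * B ≤ L * ((2 * N + 1) * B) :=
    le_mul_of_one_le_left (by positivity) hL
  have hBN : B ≤ (2 * N + 1) * B := le_mul_of_one_le_left hB (by linarith)
  -- in the first step the drift is at most `2 * G`, and the kick dominates it in the mode `0`
  have hgc : ∀ n, Continuous fun x => g (trigPoly N (c n) x) := fun n =>
    hg.comp (continuous_trigPoly N _)
  have hdrift : ∀ j, |s j * ∫ x, trigFun j x * g (trigPoly N (c 0) x) ∂lam| ≤ 2 * G := by
    intro j
    rw [abs_mul, abs_of_pos (hspos j)]
    have h1 := abs_integral_trigFun_mul_le (hgc 0) hG j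
    have h2 := mul_le_of_le_one_left (abs_nonneg (∫ x, trigFun j x * g (trigPoly N (c 0) x) ∂lam))
      (hs1 j)
    linarith
  have hone : (0 : ℕ) < N := by omega
  have hc10 : R + (2 * N + 1) * ((2 * G + B) * 2) ≤ c 1 0 := by
    have h1 := hc 0 hone 0 (zero_mem_Icc_neg N)
    have h2 := (abs_le.1 (hdrift 0)).1
    rw [zero_add] at h1
    linarith
  have hbox : 0 ≤ (2 * N + 1) * ((2 * G + B) * 2) := by positivity
  have hc1j : ∀ j ∈ Finset.Icc (-(N : ℤ)) N, |if j = 0 then 0 else c 1 j| ≤ 2 * G + B := by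
    intro j hj
    split_ifs with h0
    · rw [abs_zero]
      linarith
    · have h1 := hc 0 hone j hj
      rw [zero_add] at h1
      rw [h1]
      exact (abs_add_le _ _).trans (add_le_add (hdrift j) (hZ 0 hone j hj (by simp [h0])))
  have hZn : ∀ n, 1 ≤ n → n < N → ∀ j ∈ Finset.Icc (-(N : ℤ)) N, |Z n j| ≤ B := by
    intro n hn hnN j hj
    exact hZ n hnN j hj (by omega)
  -- consequences of `R ≤ A`
  have hApow : ∀ A, R ≤ A → A ^ 2 ≤ A ^ q ∧ 100 * (D + L * ((2 * N + 1) * B)) ≤ |β| * A ^ q := by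
    intro A hA
    have h1 : A ^ 2 ≤ A ^ q := pow_le_pow_right₀ (hR.trans hA) hq
    have h2 : R ≤ A ^ 2 := by nlinarith
    exact ⟨h1, hR1.trans (mul_le_mul_of_nonneg_left (h2.trans h1) hβ0.le)⟩
  have hfinish : ∀ A, (2 : ℝ) ^ 2 ^ (N - 1) ≤ κ * A → A ≤ coeffNorm N (c N) →
      (2 : ℝ) ^ 2 ^ (N - 1) ≤ coeffNorm N (c N) := by
    intro A h1 h2
    have h3 : κ * A ≤ κ * coeffNorm N (c N) := mul_le_mul_of_nonneg_left h2 hκ0.le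
    have h4 := mul_le_of_le_one_left (coeffNorm_nonneg N (c N)) hκ1
    linarith
  have hc0le : ∀ n, |c n 0| ≤ coeffNorm N (c n) := fun n =>
    abs_le_coeffNorm (c n) (zero_mem_Icc_neg N)
  rcases Nat.even_or_odd q with hqe | hqo
  · obtain ⟨A, hA, hgood⟩ := exists_large_of_step (Good := fun n A => A = |c n 0|) hN hκ0
      (by linarith) hκR ⟨|c 1 0|, le_trans (by linarith) (le_abs_self _), rfl⟩ (by
        intro n hn hnN A hRA hA
        have h1 := hc n hnN 0 (zero_mem_Icc_neg N)
        simp only [trigFun_zero, one_mul, hs0] at h1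
        have h2 := le_abs_coeff_zero_of_even hqe hg hgβ h1 (hZn n hn hnN 0 (zero_mem_Icc_neg N))
        rw [← hA] at h2
        obtain ⟨h3, h4⟩ := hApow A hRA
        refine ⟨_, ?_, rfl⟩
        have h5 : κ * A ^ 2 ≤ |β| / 4 * A ^ q :=
          mul_le_mul hκ4 h3 (sq_nonneg A) (by positivity)
        linarith)
    exact hfinish A hA (hgood ▸ hc0le N)
  rcases hs with ⟨hexp, hε⟩ | hres
  · obtain ⟨A, hA, σ, hσ, hgood, -⟩ := exists_large_of_step
      (Good := fun n A => ∃ σ : ℝ, (σ = 1 ∨ σ = -1) ∧ A = σ * c n 0 ∧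
        ∀ x, -(σ * c n 0 / 4) ≤ σ * trigPoly N (c n) x) hN hκ0
      (by linarith) hκR (by
        -- the nonconstant modes are small after the first step, so the state is even nonnegative
        refine ⟨c 1 0, by linarith, 1, Or.inl rfl, by ring, fun x => ?_⟩
        rw [trigPoly_eq_coeff_zero_add]
        have := (abs_le.1 (abs_trigPoly_le hc1j x)).1
        linarith) (by
        rintro n hn hnN A hRA ⟨σ, hσ, hA, hcone⟩
        obtain ⟨h3, h4⟩ := hApow A hRA
        have hq3 : 3 ≤ q := by
          obtain ⟨k, hk⟩ := hqo
          omega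
        have h1 := hc n hnN
        simp only [hexp] at h1
        obtain ⟨σ', hσ', h5, h6⟩ := exists_sign_of_odd_exp hT hN hε hqo hq3 hg hD hgβ h1
          (hZn n hn hnN) hσ (by linarith) hcone (by rw [← hA]; linarith)
        refine ⟨_, ?_, σ', hσ', rfl, h6⟩
        rw [← hA] at h5
        exact (mul_le_mul hκ4 h3 (sq_nonneg A) (by positivity)).trans h5)
    refine hfinish A hA (le_trans ?_ (hc0le N))
    rw [hgood]
    refine (le_abs_self _).trans ?_
    rw [abs_mul, abs_sign hσ, one_mul]
  · obtain ⟨A, hA, hgood⟩ := exists_large_of_step (Good := fun n A => A = coeffNorm N (c n)) hN hκ0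
      (by linarith) hκR ⟨_, le_trans (by linarith [le_abs_self (c 1 0)]) (hc0le 1), rfl⟩ (by
        intro n hn hnN A hRA hA
        have h2 := le_mul_coeffNorm_of_odd hqo hg hD hL0.le hgβ hspos hres (hc n hnN)
          (hZn n hn hnN)
        rw [← hA] at h2
        refine ⟨_, ?_, rfl⟩
        set A' := coeffNorm N (c (n + 1))
        set W := L * ((2 * N + 1) * B) with hW
        have hW0 : 0 ≤ W := by positivity
        have hA1 : 1 ≤ A := hR.trans hRA
        have hA0 : 0 < A := by linarith
        have h3 : A ^ 3 ≤ A ^ (q + 1) := pow_le_pow_right₀ hA1 (by omega)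
        have h4 : 100 * (D + W) ≤ |β| * A := hR1.trans (mul_le_mul_of_nonneg_left hRA hβ0.le)
        have h5 : 100 * (D + W) * A ^ 2 ≤ |β| * A ^ 3 := by
          have := mul_le_mul_of_nonneg_right h4 (sq_nonneg A)
          linarith
        have h6 : A ≤ A ^ 2 := by nlinarith
        have h7 : D * (1 + A ^ 2) ≤ 2 * D * A ^ 2 := by nlinarith
        have h8 : W * A ≤ W * A ^ 2 := mul_le_mul_of_nonneg_left h6 hW0
        have h9 : |β| * A ^ 3 ≤ |β| * A ^ (q + 1) := mul_le_mul_of_nonneg_left h3 hβ0.le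
        have h10 : (2 * N + 1) * (L * B) * A = W * A := by
          rw [hW]
          ring
        rw [h10] at h2
        have h11 : |β| / 4 * A ^ 2 * A ≤ L * A' * A := by
          have h12 : 0 ≤ (D + W) * A ^ 2 := by positivity
          have h13 : |β| / 4 * A ^ 2 * A = |β| * A ^ 3 / 4 := by ring
          have h14 : 0 ≤ W * A ^ 2 := by positivity
          have h15 : 0 ≤ D * A ^ 2 := by positivity
          linarith
        have h12 := le_of_mul_le_mul_right h11 hA0
        have h13 : κ * A ^ 2 = |β| / 4 * A ^ 2 / L := by
          rw [hκ]
          field_simp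
        rw [h13, div_le_iff₀ hL0]
        linarith)
    exact hfinish A hA hgood.le

/-! ### The scheme in Fourier coefficients -/

lemma inner_e_e (m n : ℤ) : inner ℝ (e m) (e n) = if m = n then (1 : ℝ) else 0 :=
  orthonormal_iff_ite.1 orthonormal_e m n

lemma inner_diag (m : ℤ → ℝ) (v : (diag m).domain) (j : ℤ) :
    inner ℝ (e j) (diag m v) = m j * inner ℝ (e j) (v : H) := by
  have hs : Summable fun n => (m n * inner ℝ (e n) (v : H)) • e n :=
    summable_smul_e (mem_diag_domain.1 v.2)
  rw [diag_apply, ← innerSL_apply_apply ℝ, ContinuousLinearMap.map_tsum _ hs]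
  simp only [innerSL_apply_apply, real_inner_smul_right, inner_e_e]
  rw [tsum_eq_single j fun n hn => by simp [hn.symm]]
  simp

lemma inner_of_isExp {E : Type*} [NormedAddCommGroup E] [NormedSpace ℝ E] {J : H →L[ℝ] E} {t : ℝ}
    {S : E →L[ℝ] H} (h : IsExp J t S) (v : H) (j : ℤ) :
    inner ℝ (e j) (S (J v))
      = Real.exp (t * (-4 * Real.pi ^ 2 * (j : ℝ) ^ 2)) * inner ℝ (e j) v := by
  obtain ⟨hv, hS⟩ := h v
  rw [hS]
  exact inner_diag _ ⟨v, hv⟩ j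

lemma inner_of_isResolvent {E : Type*} [NormedAddCommGroup E] [NormedSpace ℝ E] {J : H →L[ℝ] E}
    {t : ℝ} (ht : 0 ≤ t) {S : E →L[ℝ] H} (h : IsResolvent J t S) (v : H) (j : ℤ) :
    inner ℝ (e j) (S (J v))
      = (1 + t * (4 * Real.pi ^ 2 * (j : ℝ) ^ 2))⁻¹ * inner ℝ (e j) v := by
  obtain ⟨hv, hS⟩ := h.right_inv v
  have h1 := congrArg (inner ℝ (e j)) hS
  have h3 : inner ℝ (e j) (A ⟨S (J v), hv⟩)
      = -4 * Real.pi ^ 2 * (j : ℝ) ^ 2 * inner ℝ (e j) (S (J v)) := inner_diag _ ⟨S (J v), hv⟩ j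
  rw [inner_sub_right, real_inner_smul_right, h3] at h1
  have h2 : 0 < 1 + t * (4 * Real.pi ^ 2 * (j : ℝ) ^ 2) := by positivity
  rw [eq_inv_mul_iff_mul_eq₀ h2.ne', ← h1]
  ring

lemma inner_P {N : ℕ} (v : H) {j : ℤ} (hj : j ∈ Finset.Icc (-(N : ℤ)) N) :
    inner ℝ (e j) (P N v) = inner ℝ (e j) v := by
  rw [P, inner_sum]
  simp only [real_inner_smul_right, inner_e_e, mul_ite, mul_one, mul_zero]
  rw [Finset.sum_ite_eq, if_pos hj]

lemma trigPoly_congr {N : ℕ} {c c' : ℤ → ℝ} (h : ∀ j ∈ Finset.Icc (-(N : ℤ)) N, c j = c' j) :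
    trigPoly N c = trigPoly N c' := by
  ext x
  exact Finset.sum_congr rfl fun j hj => by rw [h j hj]

lemma coeFn_P (N : ℕ) (v : H) :
    P N v =ᵐ[lam] trigPoly N fun j => inner ℝ (e j) (P N v) := by
  rw [trigPoly_congr fun j hj => inner_P v hj]
  have h : ∀ n ∈ Finset.Icc (-(N : ℤ)) N,
      (inner ℝ (e n) v • e n : H) =ᵐ[lam] fun x => inner ℝ (e n) v * trigFun n x := by
    intro n _
    filter_upwards [Lp.coeFn_smul (inner ℝ (e n) v) (e n), (memLp_trigFun n).coeFn_toLp]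
      with x h1 h2
    rw [h1, Pi.smul_apply, smul_eq_mul, e, h2]
  have h2 := Lp.coeFn_finsetSum (Finset.Icc (-(N : ℤ)) N) fun n => (inner ℝ (e n) v • e n : H)
  have h3 : ∀ᵐ x ∂lam, ∀ n ∈ Finset.Icc (-(N : ℤ)) N,
      (inner ℝ (e n) v • e n : H) x = inner ℝ (e n) v * trigFun n x :=
    (Finset.eventually_all _).2 h
  filter_upwards [h2, h3] with x h4 h5
  rw [P, h4, Finset.sum_apply, trigPoly]
  exact Finset.sum_congr rfl h5

lemma norm_P (N : ℕ) (v : H) : ‖P N v‖ = coeffNorm N fun j => inner ℝ (e j) (P N v) := by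
  have h : ‖P N v‖ ^ 2 = ∑ n ∈ Finset.Icc (-(N : ℤ)) N, inner ℝ (e n) (P N v) ^ 2 := by
    rw [← real_inner_self_eq_norm_sq]
    conv_lhs => rw [P, sum_inner]
    refine Finset.sum_congr rfl fun n hn => ?_
    rw [← P, real_inner_smul_left, inner_P v hn, sq]
  rw [coeffNorm, ← h, Real.sqrt_sq (norm_nonneg _)]

lemma memLp_of_continuous {f : ℝ → ℝ} (hf : Continuous f) : MemLp f 2 lam := by
  obtain ⟨C, hC⟩ := isCompact_Icc.exists_bound_of_continuousOn (s := Set.Icc (0 : ℝ) 1)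
    hf.continuousOn
  refine MemLp.of_bound hf.aestronglyMeasurable C ?_
  filter_upwards [ae_restrict_mem measurableSet_Ioo] with x hx
  exact hC x (Set.Ioo_subset_Icc_self hx)

/-- One explicit Euler step `y + h ∑ a_k y^k` of the scalar equation without noise. -/
def eulerMap (h : ℝ) (q : ℕ) (a : ℕ → ℝ) (y : ℝ) : ℝ :=
  y + h * ∑ k ∈ Finset.range (q + 1), a k * y ^ k

lemma continuous_eulerMap (h : ℝ) (q : ℕ) (a : ℕ → ℝ) : Continuous (eulerMap h q a) := by
  unfold eulerMap
  fun_prop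

lemma inner_add_smul_nemytskii (h : ℝ) (q : ℕ) (a : ℕ → ℝ) {v : H} {y : ℝ → ℝ}
    (hy : Continuous y) (hv : v =ᵐ[lam] y) (j : ℤ) :
    inner ℝ (e j) (v + h • nemytskii q a v)
      = ∫ x, trigFun j x * eulerMap h q a (y x) ∂lam := by
  have hae : (fun x => ∑ k ∈ Finset.range (q + 1), a k * (v x) ^ k)
      =ᵐ[lam] fun x => ∑ k ∈ Finset.range (q + 1), a k * (y x) ^ k := by
    filter_upwards [hv] with x hx
    rw [hx]
  have hmem : MemLp (fun x => ∑ k ∈ Finset.range (q + 1), a k * (v x) ^ k) 2 lam :=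
    (memLp_of_continuous (by fun_prop)).ae_eq hae.symm
  rw [nemytskii, dif_pos hmem, MeasureTheory.L2.inner_def]
  refine integral_congr_ae ?_
  filter_upwards [Lp.coeFn_add v (h • hmem.toLp _), Lp.coeFn_smul h (hmem.toLp _),
    hmem.coeFn_toLp, hae, hv, (memLp_trigFun j).coeFn_toLp] with x h1 h2 h3 h4 h5 h6
  rw [h1, Pi.add_apply, h2, Pi.smul_apply, h3, h4, h5, e, h6, eulerMap]
  simp [mul_comm]

/-- The Fourier coefficients of the scheme satisfy the recursion analysed above. -/
lemma inner_P_step {E : Type*} [NormedAddCommGroup E] [NormedSpace ℝ E] {J : H →L[ℝ] E}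
    {S : E →L[ℝ] H} {s : ℤ → ℝ} (hS : ∀ v j, inner ℝ (e j) (S (J v)) = s j * inner ℝ (e j) v)
    {N : ℕ} (h : ℝ) (q : ℕ) (a : ℕ → ℝ) (v : H) (w : E) {j : ℤ}
    (hj : j ∈ Finset.Icc (-(N : ℤ)) N) :
    inner ℝ (e j) (P N (S (J (P N v + h • nemytskii q a (P N v)) + w)))
      = s j * ∫ x, trigFun j x *
          eulerMap h q a (trigPoly N (fun j => inner ℝ (e j) (P N v)) x) ∂lam
        + inner ℝ (e j) (S w) := by
  rw [inner_P _ hj, map_add, inner_add_right, hS,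
    inner_add_smul_nemytskii h q a (continuous_trigPoly N _) (coeFn_P N v)]

/-- The lower order terms of the Euler map are dominated by half of the leading term, up to a
constant that grows polynomially in the inverse step size. -/
lemma abs_eulerMap_sub_le {T h : ℝ} (hh : 0 < h) (hhT : h ≤ T) {q : ℕ} (hq : 2 ≤ q) {a : ℕ → ℝ}
    (ha : a q ≠ 0) {C : ℝ} (hC : C = 1 + T * ∑ k ∈ Finset.range q, |a k|) (y : ℝ) :
    |eulerMap h q a y - h * a q * y ^ q|
      ≤ |h * a q| / 2 * |y| ^ q + (2 * C + C * (2 * C / (h * |a q|)) ^ (q - 1)) := by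
  have hpow : ∀ k < q, |y| ^ k ≤ 1 + |y| ^ (q - 1) := by
    intro k hk
    rcases le_total |y| 1 with h1 | h1
    · have := pow_le_one₀ (n := k) (abs_nonneg y) h1
      have h2 : 0 ≤ |y| ^ (q - 1) := by positivity
      linarith
    · have := pow_le_pow_right₀ h1 (show k ≤ q - 1 by omega)
      linarith
  have hsum0 : 0 ≤ ∑ k ∈ Finset.range q, |a k| := Finset.sum_nonneg fun _ _ => abs_nonneg _
  have hT : 0 < T := hh.trans_le hhT
  have hC1 : 1 ≤ C := by
    rw [hC]
    nlinarith
  have h1 : |eulerMap h q a y - h * a q * y ^ q| ≤ C * (1 + |y| ^ (q - 1)) := by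
    have h2 : eulerMap h q a y - h * a q * y ^ q = y + h * ∑ k ∈ Finset.range q, a k * y ^ k := by
      rw [eulerMap, Finset.sum_range_succ]
      ring
    have h3 : |∑ k ∈ Finset.range q, a k * y ^ k|
        ≤ (∑ k ∈ Finset.range q, |a k|) * (1 + |y| ^ (q - 1)) := by
      rw [Finset.sum_mul]
      refine (Finset.abs_sum_le_sum_abs _ _).trans (Finset.sum_le_sum fun k hk => ?_)
      rw [abs_mul, abs_pow]
      exact mul_le_mul_of_nonneg_left (hpow k (Finset.mem_range.1 hk)) (abs_nonneg _)
    rw [h2]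
    refine (abs_add_le _ _).trans ?_
    rw [abs_mul, abs_of_pos hh]
    have h4 : h * |∑ k ∈ Finset.range q, a k * y ^ k|
        ≤ T * ((∑ k ∈ Finset.range q, |a k|) * (1 + |y| ^ (q - 1))) :=
      mul_le_mul hhT h3 (abs_nonneg _) hT.le
    have h5 := hpow 1 (by omega)
    rw [pow_one] at h5
    rw [hC]
    linarith
  have hb : 0 < h * |a q| := mul_pos hh (abs_pos.2 ha)
  have h2 : C * |y| ^ (q - 1)
      ≤ |h * a q| / 2 * |y| ^ q + C * (2 * C / (h * |a q|)) ^ (q - 1) := by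
    rw [abs_mul, abs_of_pos hh]
    rcases le_total |y| (2 * C / (h * |a q|)) with h3 | h3
    · have h4 : |y| ^ (q - 1) ≤ (2 * C / (h * |a q|)) ^ (q - 1) :=
        pow_le_pow_left₀ (abs_nonneg _) h3 _
      have h5 : 0 ≤ h * |a q| / 2 * |y| ^ q := by positivity
      nlinarith
    · rw [div_le_iff₀ hb] at h3
      have h5 : |y| ^ q = |y| * |y| ^ (q - 1) := by
        rw [← pow_succ']
        congr 1
        omega
      have h6 : 0 ≤ C * (2 * C / (h * |a q|)) ^ (q - 1) := by positivity
      have h7 : 0 ≤ |y| ^ (q - 1) := by positivity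
      rw [h5]
      nlinarith
  linarith

/-! ### The noise -/

lemma ofReal_gaussianPDFReal_le_gaussianReal {v : ℝ≥0} (hv : v ≠ 0) {M : ℝ} (hM : 0 ≤ M) :
    ENNReal.ofReal (gaussianPDFReal 0 v (M + 1)) ≤ gaussianReal 0 v (Set.Icc M (M + 1)) := by
  rw [gaussianReal_apply 0 hv]
  calc ENNReal.ofReal (gaussianPDFReal 0 v (M + 1))
      = ∫⁻ _ in Set.Icc M (M + 1), ENNReal.ofReal (gaussianPDFReal 0 v (M + 1)) := by
        rw [setLIntegral_const, Real.volume_Icc]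
        simp
    _ ≤ ∫⁻ x in Set.Icc M (M + 1), gaussianPDF 0 v x := by
        refine setLIntegral_mono' measurableSet_Icc fun x hx => ?_
        rw [gaussianPDF]
        refine ENNReal.ofReal_le_ofReal ?_
        rw [gaussianPDFReal, gaussianPDFReal]
        have h1 : (x - 0) ^ 2 ≤ (M + 1 - 0) ^ 2 := by
          rw [sub_zero, sub_zero]
          exact pow_le_pow_left₀ (hM.trans hx.1) hx.2 2
        gcongr

/-- Chebyshev's inequality for a centred normal variable. -/
lemma half_le_gaussianReal {v : ℝ≥0} {B : ℝ} (hB : 0 < B) (hv : 2 * (v : ℝ) ≤ B ^ 2) :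
    (1 / 2 : ℝ≥0∞) ≤ gaussianReal 0 v (Set.Icc (-B) B) := by
  have h1 := meas_ge_le_variance_div_sq (μ := gaussianReal 0 v) (X := id)
    (memLp_id_gaussianReal 2) hB
  simp only [id_eq, integral_id_gaussianReal, sub_zero, variance_id_gaussianReal] at h1
  have h2 : ENNReal.ofReal (v / B ^ 2) ≤ 1 / 2 := by
    rw [show (1 / 2 : ℝ≥0∞) = ENNReal.ofReal (1 / 2) by
      rw [ENNReal.ofReal_div_of_pos (by norm_num)]; simp]
    refine ENNReal.ofReal_le_ofReal ?_
    rw [div_le_div_iff₀ (by positivity) (by norm_num)]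
    linarith
  have h3 : (Set.Icc (-B) B)ᶜ ⊆ {x : ℝ | B ≤ |x|} := by
    intro x hx
    rw [Set.mem_compl_iff, Set.mem_Icc, ← abs_le, not_le] at hx
    exact hx.le
  have h4 : gaussianReal 0 v (Set.Icc (-B) B)ᶜ ≤ 1 / 2 := (measure_mono h3).trans (h1.trans h2)
  rw [prob_compl_eq_one_sub measurableSet_Icc, tsub_le_iff_right] at h4
  have h5 : (1 / 2 : ℝ≥0∞) + 1 / 2 = 1 := ENNReal.add_halves 1
  exact (ENNReal.add_le_add_iff_left (by simp)).1 (h5.le.trans h4)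

section Noise

variable {Ω E : Type*} [MeasurableSpace Ω] {μ : Measure Ω} [IsProbabilityMeasure μ]
  [NormedAddCommGroup E] [NormedSpace ℝ E] [MeasurableSpace E]
  {J : H →L[ℝ] E} {T : ℝ} {W : ℝ → Ω → E} {S : E →L[ℝ] H} {s : ℤ → ℝ}

/-- The Fourier coefficients of a noise increment are independent centred normal variables. -/
lemma map_inner_increment (hW : IsCylindricalWiener J T W μ)
    (hS : ∀ v j, inner ℝ (e j) (S (J v)) = s j * inner ℝ (e j) v) {r t : ℝ} (hr : 0 ≤ r)
    (hrt : r ≤ t) (htT : t ≤ T) (I : Finset ℤ) :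
    μ.map (fun ω (j : I) => inner ℝ (e j) (S (W t ω - W r ω)))
      = Measure.pi fun j : I => gaussianReal 0 ((t - r) * s j ^ 2).toNNReal := by
  have hlaw := hW.law r t hr hrt htT
  have hmeas : AEMeasurable (fun ω (j : I) => inner ℝ (e j) (S (W t ω - W r ω))) μ :=
    aemeasurable_pi_lambda _ fun j => (hlaw ((innerSL ℝ (e j)).comp S)).aemeasurable
  have : IsProbabilityMeasure (μ.map (fun ω (j : I) => inner ℝ (e j) (S (W t ω - W r ω)))) :=
    Measure.isProbabilityMeasure_map hmeas
  rw [← charFun_eq_pi_iff]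
  intro x
  set φ : E →L[ℝ] ℝ := ∑ j : I, x j • (innerSL ℝ (e j)).comp S with hφ
  have hφ_apply : ∀ y, φ y = ∑ j : I, x j * inner ℝ (e j) (S y) := by
    intro y
    rw [hφ]
    simp
  have hφJ : ‖φ.comp J‖ ^ 2 = ∑ j : I, (x j * s j) ^ 2 := by
    have h1 : φ.comp J = innerSL ℝ (∑ j : I, (x j * s j) • e j) := by
      ext v
      rw [ContinuousLinearMap.comp_apply, hφ_apply, innerSL_apply_apply, sum_inner]
      refine Finset.sum_congr rfl fun j _ => ?_
      rw [hS, real_inner_smul_left]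
      ring
    rw [h1, innerSL_apply_norm, ← real_inner_self_eq_norm_sq, sum_inner]
    refine Finset.sum_congr rfl fun j _ => ?_
    rw [inner_sum, Finset.sum_eq_single j]
    · rw [real_inner_smul_left, real_inner_smul_right, inner_e_e, if_pos rfl]
      ring
    · intro i _ hij
      rw [real_inner_smul_left, real_inner_smul_right, inner_e_e, if_neg]
      · simp
      · intro h
        exact hij (Subtype.ext h.symm)
    · simp
  have h1 : charFun ((μ.map (fun ω (j : I) => inner ℝ (e j) (S (W t ω - W r ω)))).map
      (WithLp.toLp 2)) x = charFun (μ.map fun ω => φ (W t ω - W r ω)) 1 := by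
    rw [charFun_apply, charFun_apply, integral_map (by fun_prop)
      (by fun_prop), integral_map hmeas (by fun_prop),
      integral_map (hlaw φ).aemeasurable (by fun_prop)]
    congr 1
    ext ω
    rw [PiLp.inner_apply, hφ_apply]
    simp
  rw [h1, (hlaw φ).map_eq, charFun_gaussianReal, hφJ]
  simp_rw [charFun_gaussianReal]
  rw [← Complex.exp_sum]
  congr 1
  have h2 : 0 ≤ t - r := sub_nonneg.2 hrt
  have h3 : ∀ j : I, ((t - r) * s j ^ 2).toNNReal = (t - r) * s j ^ 2 := fun j =>
    Real.coe_toNNReal _ (mul_nonneg h2 (sq_nonneg _))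
  have h4 : (((t - r) * ∑ j : I, (x j * s j) ^ 2).toNNReal : ℝ)
      = (t - r) * ∑ j : I, (x j * s j) ^ 2 :=
    Real.coe_toNNReal _ (mul_nonneg h2 (Finset.sum_nonneg fun _ _ => sq_nonneg _))
  simp only [Complex.ofReal_zero, mul_zero, zero_mul, zero_sub]
  rw [Finset.sum_neg_distrib, ← Finset.sum_div]
  congr 2
  rw [h4]
  simp_rw [h3]
  push_cast
  rw [Finset.mul_sum]
  simp only [one_pow, mul_one]
  exact Finset.sum_congr rfl fun j _ => by ring

/-- The event that the constant mode of the first noise increment lies in `[M, M + 1]`, and that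
all other modes of the increments are at most `B` in absolute value. -/
def kickEvent (T : ℝ) (W : ℝ → Ω → E) (S : E →L[ℝ] H) (N : ℕ) (M B : ℝ) : Set Ω :=
  ⋂ n ∈ Finset.range N, {ω | ∀ j ∈ Finset.Icc (-(N : ℤ)) N,
    inner ℝ (e j) (S (W ((n + 1) * T / N) ω - W (n * T / N) ω))
      ∈ if n = 0 ∧ j = 0 then Set.Icc M (M + 1) else Set.Icc (-B) B}

lemma le_measure_kickEvent [BorelSpace E] (hW : IsCylindricalWiener J T W μ) (hT : 0 < T)
    (hS : ∀ v j, inner ℝ (e j) (S (J v)) = s j * inner ℝ (e j) v) (hs0 : s 0 = 1)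
    (hspos : ∀ n, 0 < s n) (hs1 : ∀ n, s n ≤ 1) {N : ℕ} (hN : 1 ≤ N) {M B : ℝ} (hM : 0 ≤ M)
    (hB : 0 < B) (hB2 : 2 * T ≤ B ^ 2) :
    NullMeasurableSet (kickEvent T W S N M B) μ ∧
    ENNReal.ofReal (gaussianPDFReal 0 (T / N).toNNReal (M + 1)) * (1 / 2) ^ (N * (2 * N + 1))
      ≤ μ (kickEvent T W S N M B) := by
  have hN0 : (0 : ℝ) < N := by exact_mod_cast hN
  have hh0 : 0 < T / N := by positivity
  set I := Finset.Icc (-(N : ℤ)) N with hI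
  set ρ := ENNReal.ofReal (gaussianPDFReal 0 (T / N).toNNReal (M + 1)) with hρ
  set box : ℕ → ℤ → Set ℝ := fun n j =>
    if n = 0 ∧ j = 0 then Set.Icc M (M + 1) else Set.Icc (-B) B with hbox
  have hboxm : ∀ n j, MeasurableSet (box n j) := by
    intro n j
    rw [hbox]
    simp only
    split_ifs <;> exact measurableSet_Icc
  set X : ℕ → Ω → I → ℝ := fun n ω j =>
    inner ℝ (e j) (S (W ((n + 1) * T / N) ω - W (n * T / N) ω)) with hX
  set ev : ℕ → Set Ω := fun n => {ω | ∀ j ∈ I,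
    inner ℝ (e j) (S (W ((n + 1) * T / N) ω - W (n * T / N) ω)) ∈ box n j} with hev
  have hev2 : ∀ n, ev n = X n ⁻¹' Set.univ.pi fun j : I => box n j := by
    intro n
    ext ω
    simp [hev, hX]
  have hkick : kickEvent T W S N M B = ⋂ n ∈ Finset.range N, ev n := rfl
  have hdiff : ∀ n : ℕ, ((n : ℝ) + 1) * T / N - n * T / N = T / N := by
    intro n
    ring
  have h0n : ∀ n : ℕ, 0 ≤ (n : ℝ) * T / N := fun n => by positivity
  have hmono : ∀ n : ℕ, (n : ℝ) * T / N ≤ (n + 1) * T / N := by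
    intro n
    have := hdiff n
    linarith
  have hle : ∀ n < N, ((n : ℝ) + 1) * T / N ≤ T := by
    intro n hn
    rw [div_le_iff₀ hN0, mul_comm T]
    have : (n : ℝ) + 1 ≤ N := by exact_mod_cast hn
    exact mul_le_mul_of_nonneg_right this hT.le
  have hXm : ∀ n < N, AEMeasurable (X n) μ := fun n hn =>
    aemeasurable_pi_lambda _ fun j =>
      (hW.law _ _ (h0n n) (hmono n) (hle n hn) ((innerSL ℝ (e j)).comp S)).aemeasurable
  have hpim : ∀ n, MeasurableSet (Set.univ.pi fun j : I => box n j) := fun n =>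
    MeasurableSet.univ_pi fun j => hboxm n j
  refine ⟨?_, ?_⟩
  · rw [hkick]
    refine Finset.nullMeasurableSet_biInter _ fun n hn => ?_
    rw [hev2]
    exact (hXm n (Finset.mem_range.1 hn)).nullMeasurableSet_preimage (hpim n)
  have hmeas : ∀ n < N, μ (ev n) = ∏ j : I, gaussianReal 0 (T / N * s j ^ 2).toNNReal (box n j) := by
    intro n hn
    rw [hev2, ← Measure.map_apply_of_aemeasurable (hXm n hn) (hpim n), hX,
      map_inner_increment hW hS (h0n n) (hmono n) (hle n hn) I, Measure.pi_pi, hdiff]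
  have hindep : μ (⋂ n ∈ Finset.range N, ev n) = ∏ n ∈ Finset.range N, μ (ev n) := by
    let t : ℕ → Set.Icc (0 : ℝ) T := fun n => ⟨min ((n : ℝ) * T / N) T,
      le_min (h0n n) hT.le, min_le_right _ _⟩
    have ht : Monotone t := by
      intro m n hmn
      have : (m : ℝ) ≤ n := by exact_mod_cast hmn
      refine min_le_min_right T ?_
      gcongr
    refine (hW.indep.nat ht).meas_biInter fun n hn => ?_
    have hn' := Finset.mem_range.1 hn
    have h1 : ((t n : Set.Icc (0 : ℝ) T) : ℝ) = n * T / N :=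
      min_eq_left ((hmono n).trans (hle n hn'))
    have h2 : ((t (n + 1) : Set.Icc (0 : ℝ) T) : ℝ) = (n + 1) * T / N := by
      have := hle n hn'
      simp only [t]
      push_cast
      exact min_eq_left this
    rw [h1, h2]
    refine ⟨{y | ∀ j ∈ I, inner ℝ (e j) (S y) ∈ box n j}, ?_, rfl⟩
    have h3 : {y : E | ∀ j ∈ I, inner ℝ (e j) (S y) ∈ box n j}
        = ⋂ j ∈ I, (fun y => inner ℝ (e j) (S y)) ⁻¹' box n j := by
      ext y
      simp
    rw [h3]
    refine Finset.measurableSet_biInter _ fun j _ => ?_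
    exact ((innerSL ℝ (e j)).comp S).continuous.measurable (hboxm n j)
  have hfactor : ∀ n (j : I), (if n = 0 then if j = ⟨0, zero_mem_Icc_neg N⟩ then ρ else 1 else 1)
      * (1 / 2) ≤ gaussianReal 0 (T / N * s j ^ 2).toNNReal (box n j) := by
    intro n j
    by_cases hnj : n = 0 ∧ (j : ℤ) = 0
    · obtain ⟨rfl, hj⟩ := hnj
      have hj' : j = ⟨0, zero_mem_Icc_neg N⟩ := Subtype.ext hj
      rw [if_pos rfl, if_pos hj', hj, hs0, one_pow, mul_one, hbox]
      simp only [and_self, if_true]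
      have hv : (T / N).toNNReal ≠ 0 := by
        rw [Ne, Real.toNNReal_eq_zero, not_le]
        exact hh0
      refine le_trans ?_ (ofReal_gaussianPDFReal_le_gaussianReal hv hM)
      exact mul_le_of_le_one_right' (by simp)
    · have h1 : (if n = 0 then if j = ⟨0, zero_mem_Icc_neg N⟩ then ρ else 1 else 1) = 1 := by
        split_ifs with h2 h3
        · exact absurd ⟨h2, congrArg Subtype.val h3⟩ hnj
        · rfl
        · rfl
      rw [h1, one_mul, hbox]
      simp only [if_neg hnj]
      refine half_le_gaussianReal hB ?_
      rw [Real.coe_toNNReal _ (by positivity)]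
      have h2 : T / N ≤ T := div_le_self hT.le (by exact_mod_cast hN)
      have h3 : s j ^ 2 ≤ 1 := pow_le_one₀ (hspos j).le (hs1 j)
      have h4 : T / N * s j ^ 2 ≤ T * 1 := mul_le_mul h2 h3 (sq_nonneg _) hT.le
      linarith
  rw [hkick, hindep]
  calc ρ * (1 / 2) ^ (N * (2 * N + 1))
      = ∏ n ∈ Finset.range N, ∏ j : I,
          (if n = 0 then if j = ⟨0, zero_mem_Icc_neg N⟩ then ρ else 1 else 1) * (1 / 2) := by
        have hcard : Fintype.card I = 2 * N + 1 := by
          rw [Fintype.card_coe, hI, Int.card_Icc]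
          omega
        simp_rw [Finset.prod_mul_distrib, Finset.prod_const, Finset.card_univ, hcard,
          Finset.card_range]
        rw [← pow_mul, mul_comm (2 * N + 1) N]
        congr 1
        rw [Finset.prod_eq_single 0]
        · simp
        · intro n _ hn
          simp [hn]
        · intro h
          exact absurd (Finset.mem_range.2 (by omega)) h
    _ ≤ ∏ n ∈ Finset.range N, ∏ j : I, gaussianReal 0 (T / N * s j ^ 2).toNNReal (box n j) :=
        Finset.prod_le_prod' fun n _ => Finset.prod_le_prod' fun j _ => hfactor n j
    _ = ∏ n ∈ Finset.range N, μ (ev n) :=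
        Finset.prod_congr rfl fun n hn => (hmeas n (Finset.mem_range.1 hn)).symm

end Noise

/-! ### Polynomially bounded sequences -/

/-- `f N = O(N ^ K)` for some `K`, with a bound that is valid for all `N ≥ 1`. -/
def PolyBdd (f : ℕ → ℝ) : Prop := ∃ (C : ℝ) (K : ℕ), ∀ N : ℕ, 1 ≤ N → |f N| ≤ C * (N : ℝ) ^ K

namespace PolyBdd

lemma const (c : ℝ) : PolyBdd fun _ => c := ⟨|c|, 0, fun N _ => by simp⟩

lemma natCast : PolyBdd fun N => (N : ℝ) := ⟨1, 1, fun N _ => by simp⟩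

lemma mul {f g : ℕ → ℝ} (hf : PolyBdd f) (hg : PolyBdd g) : PolyBdd fun N => f N * g N := by
  obtain ⟨C, K, h⟩ := hf
  obtain ⟨C', K', h'⟩ := hg
  refine ⟨C * C', K + K', fun N hN => ?_⟩
  rw [abs_mul]
  calc |f N| * |g N| ≤ (C * N ^ K) * (C' * N ^ K') :=
        mul_le_mul (h N hN) (h' N hN) (abs_nonneg _) ((abs_nonneg _).trans (h N hN))
    _ = C * C' * N ^ (K + K') := by ring

lemma add {f g : ℕ → ℝ} (hf : PolyBdd f) (hg : PolyBdd g) : PolyBdd fun N => f N + g N := by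
  obtain ⟨C, K, h⟩ := hf
  obtain ⟨C', K', h'⟩ := hg
  refine ⟨|C| + |C'|, K + K', fun N hN => ?_⟩
  have hN1 : (1 : ℝ) ≤ N := by exact_mod_cast hN
  have h1 : (N : ℝ) ^ K ≤ (N : ℝ) ^ (K + K') := pow_le_pow_right₀ hN1 (Nat.le_add_right K K')
  have h2 : (N : ℝ) ^ K' ≤ (N : ℝ) ^ (K + K') := pow_le_pow_right₀ hN1 (Nat.le_add_left K' K)
  calc |f N + g N| ≤ |f N| + |g N| := abs_add_le _ _
    _ ≤ C * N ^ K + C' * N ^ K' := add_le_add (h N hN) (h' N hN)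
    _ ≤ |C| * N ^ (K + K') + |C'| * N ^ (K + K') :=
        add_le_add (mul_le_mul (le_abs_self C) h1 (by positivity) (abs_nonneg _))
          (mul_le_mul (le_abs_self C') h2 (by positivity) (abs_nonneg _))
    _ = (|C| + |C'|) * N ^ (K + K') := by ring

lemma pow {f : ℕ → ℝ} (hf : PolyBdd f) (k : ℕ) : PolyBdd fun N => f N ^ k := by
  induction k with
  | zero => simpa using const 1
  | succ k ih => simpa only [pow_succ] using ih.mul hf

lemma div_const {f : ℕ → ℝ} (hf : PolyBdd f) (c : ℝ) : PolyBdd fun N => f N / c := by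
  simpa only [div_eq_mul_inv] using hf.mul (const c⁻¹)

end PolyBdd

lemma tendsto_mul_two_pow_sub {f : ℕ → ℝ} (hf : PolyBdd f) {c : ℝ} (hc : 0 < c) :
    Tendsto (fun N : ℕ => c * 2 ^ (N - 1) - f N) atTop atTop := by
  obtain ⟨C, K, h⟩ := hf
  have h1 : Tendsto (fun N : ℕ => (N : ℝ) ^ K / 2 ^ N) atTop (𝓝 0) :=
    tendsto_pow_const_div_const_pow_of_one_lt K (by norm_num)
  have h2 : Tendsto (fun N : ℕ => c / 2 - C * ((N : ℝ) ^ K / 2 ^ N)) atTop (𝓝 (c / 2 - C * 0)) :=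
    tendsto_const_nhds.sub (h1.const_mul C)
  have h3 : Tendsto (fun N : ℕ => (2 : ℝ) ^ N) atTop atTop :=
    tendsto_pow_atTop_atTop_of_one_lt (by norm_num)
  have h4 := h3.atTop_mul_pos (C := c / 2 - C * 0) (by linarith) h2
  refine tendsto_atTop_mono' _ ?_ h4
  filter_upwards [eventually_ge_atTop 1] with N hN
  have h5 := (le_abs_self _).trans (h N hN)
  have h6 : (2 : ℝ) ^ N = 2 * 2 ^ (N - 1) := by
    rw [← pow_succ']
    congr 1
    omega
  have h7 : (2 : ℝ) ^ N * (c / 2 - C * ((N : ℝ) ^ K / 2 ^ N)) = c * 2 ^ (N - 1) - C * N ^ K := by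
    have : (2 : ℝ) ^ N ≠ 0 := by positivity
    field_simp
    rw [h6]
    ring
  rw [h7]
  linarith

/-- A Gaussian tail at polynomial height has a probability that decays much more slowly than a
doubly exponential sequence grows. -/
lemma tendsto_gaussianPDF_mul_two_pow {T p : ℝ} (hT : 0 < T) (hp : 0 < p) {M : ℕ → ℝ}
    (hM : PolyBdd M) :
    Tendsto (fun N : ℕ => ENNReal.ofReal (2 ^ 2 ^ (N - 1)) ^ p *
      (ENNReal.ofReal (gaussianPDFReal 0 (T / N).toNNReal (M N + 1))
        * (1 / 2) ^ (N * (2 * N + 1)))) atTop (𝓝 ∞) := by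
  set f : ℕ → ℝ := fun N => (M N + 1) ^ 2 * N / (2 * T)
    + Real.log 2 * (N * (2 * N + 1)) with hf
  have hfp : PolyBdd f :=
    ((((hM.add (.const 1)).pow 2).mul .natCast).div_const _).add
      ((PolyBdd.const _).mul (PolyBdd.natCast.mul (((PolyBdd.const 2).mul .natCast).add (.const 1))))
  have hlog : 0 < Real.log 2 := Real.log_pos (by norm_num)
  have h1 := tendsto_mul_two_pow_sub hfp (c := p * Real.log 2) (by positivity)
  have hc : 0 < (√(2 * Real.pi * T))⁻¹ := by
    have := Real.pi_pos
    positivity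
  have h2 := (Real.tendsto_exp_atTop.comp h1).const_mul_atTop hc
  refine tendsto_nhds_top_mono (ENNReal.tendsto_ofReal_nhds_top.2 h2) ?_
  filter_upwards [eventually_ge_atTop 1] with N hN
  have hN1 : (1 : ℝ) ≤ N := by exact_mod_cast hN
  have hN0 : (0 : ℝ) < N := by linarith
  have h3 : (1 / 2 : ℝ≥0∞) = ENNReal.ofReal (1 / 2) := by
    rw [ENNReal.ofReal_div_of_pos (by norm_num)]
    simp
  have h4 : 0 ≤ gaussianPDFReal 0 (T / N).toNNReal (M N + 1) := gaussianPDFReal_nonneg _ _ _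
  rw [h3, ← ENNReal.ofReal_pow (by norm_num), ← ENNReal.ofReal_mul h4,
    ENNReal.ofReal_rpow_of_pos (by positivity), ← ENNReal.ofReal_mul (by positivity)]
  refine ENNReal.ofReal_le_ofReal ?_
  have h5 : ((2 : ℝ) ^ 2 ^ (N - 1)) ^ p = Real.exp (p * Real.log 2 * 2 ^ (N - 1)) := by
    rw [← Real.rpow_natCast, ← Real.rpow_mul (by norm_num), Real.rpow_def_of_pos (by norm_num)]
    congr 1
    push_cast
    ring
  have h6 : (1 / 2 : ℝ) ^ (N * (2 * N + 1)) = Real.exp (-(Real.log 2 * (N * (2 * N + 1)))) := by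
    rw [← Real.rpow_natCast, Real.rpow_def_of_pos (by norm_num), one_div, Real.log_inv]
    congr 1
    push_cast
    ring
  have h7 : (√(2 * Real.pi * T))⁻¹ * Real.exp (-((M N + 1) ^ 2 * N / (2 * T)))
      ≤ gaussianPDFReal 0 (T / N).toNNReal (M N + 1) := by
    rw [gaussianPDFReal, Real.coe_toNNReal _ (by positivity), sub_zero]
    have h8 : -(M N + 1) ^ 2 / (2 * (T / N)) = -((M N + 1) ^ 2 * N / (2 * T)) := by
      field_simp
    have h9 : T / N ≤ T := div_le_self hT.le hN1
    rw [h8]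
    have := Real.pi_pos
    gcongr
  rw [h5, h6]
  simp only [Function.comp_apply]
  rw [sub_eq_add_neg, Real.exp_add, hf]
  simp only
  rw [neg_add, Real.exp_add]
  have h10 := mul_le_mul_of_nonneg_left h7
    (mul_pos (Real.exp_pos (p * Real.log 2 * 2 ^ (N - 1)))
      (Real.exp_pos (-(Real.log 2 * (N * (2 * N + 1)))))).le
  linarith

/-! ### Divergence of the moments -/

lemma exists_multiplier {E : Type*} [NormedAddCommGroup E] [NormedSpace ℝ E] {J : H →L[ℝ] E}
    {t : ℝ} (ht : 0 ≤ t) {S : E →L[ℝ] H} (h : IsExp J t S ∨ IsResolvent J t S) :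
    ∃ s : ℤ → ℝ, s 0 = 1 ∧ (∀ n, 0 < s n) ∧ (∀ n, s n ≤ 1) ∧
      (∀ v j, inner ℝ (e j) (S (J v)) = s j * inner ℝ (e j) v) ∧
      ((∀ n : ℤ, s n = Real.exp (t * (-4 * Real.pi ^ 2 * (n : ℝ) ^ 2))) ∨
        ∀ n : ℤ, s n = (1 + t * (4 * Real.pi ^ 2 * (n : ℝ) ^ 2))⁻¹) := by
  have h0 : ∀ n : ℤ, 0 ≤ t * (4 * Real.pi ^ 2 * (n : ℝ) ^ 2) := fun n => by positivity
  rcases h with h | h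
  · refine ⟨_, by simp, fun n => Real.exp_pos _, fun n => ?_, inner_of_isExp h,
      Or.inl fun _ => rfl⟩
    rw [Real.exp_le_one_iff]
    linarith [h0 n]
  · refine ⟨_, by simp, fun n => ?_, fun n => ?_, inner_of_isResolvent ht h, Or.inr fun _ => rfl⟩
    · have := h0 n
      positivity
    · exact inv_le_one_of_one_le₀ (by linarith [h0 n])

/-- On the kick event every path of the scheme grows doubly exponentially, if the constants are
chosen as in `hC`, `hD`, `hR`, `hG` and `hM`. With `L` of polynomial size in `N`, so are all of them. -/
lemma two_pow_two_pow_le_norm {Ω E : Type*} [NormedAddCommGroup E] [NormedSpace ℝ E]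
    {J : H →L[ℝ] E} {T : ℝ} (hT : 0 < T) {W : ℝ → Ω → E} {S : E →L[ℝ] H} {N q : ℕ} (hN : 1 ≤ N)
    (hq : 2 ≤ q) {a : ℕ → ℝ} (ha : a q ≠ 0) {s : ℤ → ℝ}
    (hS : ∀ v j, inner ℝ (e j) (S (J v)) = s j * inner ℝ (e j) v) (hs0 : s 0 = 1)
    (hspos : ∀ n, 0 < s n) (hs1 : ∀ n, s n ≤ 1) {B C D L R G M : ℝ}
    (hs : ((∀ n : ℤ, s n = Real.exp (T / N * (-4 * Real.pi ^ 2 * (n : ℝ) ^ 2)))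
        ∧ heatTail T N ≤ 1 / 8) ∨ ∀ n ∈ Finset.Icc (-(N : ℤ)) N, 1 ≤ L * s n)
    {ξ : H} (hC : C = 1 + T * ∑ k ∈ Finset.range q, |a k|)
    (hD : D = 2 * C + C * (2 * C / (T * |a q|) * N) ^ (q - 1))
    (hL : 1 ≤ L) (haL : T * |a q| ≤ L) (hB : 0 ≤ B)
    (hR : R = 1 + N / (T * |a q|) * (100 * (D + L * ((2 * N + 1) * B)) + 8 * L))
    (hG : G = 3 / 2 * (T * |a q|) * ((2 * N + 1) * (‖ξ‖ * 2)) ^ q + D)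
    (hM : M = 2 * G + R + (2 * N + 1) * ((2 * G + B) * 2))
    {Y : ℕ → Ω → H} (hY₀ : ∀ ω, Y 0 ω = P N ξ)
    (hY : ∀ n < N, ∀ ω, Y (n + 1) ω = P N (S (J (Y n ω + (T / N) • nemytskii q a (Y n ω))
        + (W ((n + 1) * T / N) ω - W (n * T / N) ω))))
    {ω : Ω} (hω : ω ∈ kickEvent T W S N M B) : 2 ^ 2 ^ (N - 1) ≤ ‖Y N ω‖ := by
  have hN1 : (1 : ℝ) ≤ N := by exact_mod_cast hN
  have hN0 : (0 : ℝ) < N := by linarith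
  have hh : 0 < T / N := by positivity
  have hhT : T / N ≤ T := div_le_self hT.le hN1
  have haq : 0 < |a q| := abs_pos.2 ha
  have hβ : |T / N * a q| = T / N * |a q| := by rw [abs_mul, abs_of_pos hh]
  have hsum0 : 0 ≤ ∑ k ∈ Finset.range q, |a k| := Finset.sum_nonneg fun _ _ => abs_nonneg _
  have hC0 : 0 ≤ C := by rw [hC]; positivity
  have hD0 : 0 ≤ D := by rw [hD]; positivity
  have hL0 : 0 < L := by linarith
  have hrange : ∀ n ≤ N, ∃ v, Y n ω = P N v := by
    intro n hn
    cases n with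
    | zero => exact ⟨ξ, hY₀ ω⟩
    | succ n => exact ⟨_, hY n (by omega) ω⟩
  have hg : ∀ y, |eulerMap (T / N) q a y - T / N * a q * y ^ q|
      ≤ |T / N * a q| / 2 * |y| ^ q + D := by
    intro y
    have h1 := abs_eulerMap_sub_le hh hhT hq ha hC y
    have h2 : 2 * C / (T / N * |a q|) = 2 * C / (T * |a q|) * N := by
      field_simp
    rwa [h2, ← hD] at h1
  obtain ⟨v, hv⟩ := hrange N le_rfl
  rw [hv, norm_P, ← hv]
  have hβR : |T / N * a q| * R
      = T / N * |a q| + (100 * (D + L * ((2 * N + 1) * B)) + 8 * L) := by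
    rw [hβ, hR]
    field_simp
  have hβ0 : 0 < T / N * |a q| := by positivity
  have hW0 : 0 ≤ L * ((2 * N + 1) * B) := by positivity
  have hkick : ∀ n < N, ∀ j ∈ Finset.Icc (-(N : ℤ)) N,
      inner ℝ (e j) (S (W ((n + 1) * T / N) ω - W (n * T / N) ω))
        ∈ if n = 0 ∧ j = 0 then Set.Icc M (M + 1) else Set.Icc (-B) B := by
    intro n hn
    exact Set.mem_iInter₂.1 hω n (Finset.mem_range.2 hn)
  refine two_pow_two_pow_le_coeffNorm hT hN hq (continuous_eulerMap (T / N) q a)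
    (β := T / N * a q) (c := fun n j => inner ℝ (e j) (Y n ω))
    (Z := fun n j => inner ℝ (e j) (S (W ((n + 1) * T / N) ω - W (n * T / N) ω)))
    (G := G) (B := B) (R := R)
    (mul_ne_zero hh.ne' ha) hD0 hL ?_ hg ?_ ?_ ?_ hs0 hspos hs1 hs ?_ ?_ ?_ ?_
  · rw [hβ]
    have := mul_le_mul_of_nonneg_right hhT haq.le
    linarith
  · rw [hR]
    have : 0 ≤ N / (T * |a q|) * (100 * (D + L * ((2 * N + 1) * B)) + 8 * L) := by positivity
    linarith
  · rw [hβR]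
    linarith
  · rw [hβR]
    linarith
  · intro n hn j hj
    obtain ⟨v, hv⟩ := hrange n hn.le
    have h1 := inner_P_step hS (T / N) q a v (W ((n + 1) * T / N) ω - W (n * T / N) ω) hj
    rw [← hv, ← hY n hn ω] at h1
    exact h1
  · intro x
    have h1 : ∀ j ∈ Finset.Icc (-(N : ℤ)) N, |inner ℝ (e j) (Y 0 ω)| ≤ ‖ξ‖ := by
      intro j hj
      rw [hY₀, inner_P ξ hj]
      refine (abs_real_inner_le_norm _ _).trans ?_
      rw [orthonormal_e.1 j, one_mul]
    have h2 := pow_le_pow_left₀ (abs_nonneg _) (abs_trigPoly_le h1 x) q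
    have h3 := hg (trigPoly N (fun j => inner ℝ (e j) (Y 0 ω)) x)
    set y := trigPoly N (fun j => inner ℝ (e j) (Y 0 ω)) x
    have h4 : |T / N * a q * y ^ q| = |T / N * a q| * |y| ^ q := by rw [abs_mul, abs_pow]
    have h5 := abs_sub_abs_le_abs_sub (eulerMap (T / N) q a y) (T / N * a q * y ^ q)
    have h6 : |T / N * a q| * |y| ^ q ≤ T * |a q| * ((2 * N + 1) * (‖ξ‖ * 2)) ^ q := by
      rw [hβ]
      exact mul_le_mul (mul_le_mul_of_nonneg_right hhT haq.le) h2 (by positivity) (by positivity)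
    rw [hG]
    linarith
  · have h1 := hkick 0 (by omega) 0 (zero_mem_Icc_neg N)
    rw [if_pos ⟨rfl, rfl⟩] at h1
    rw [← hM]
    exact h1.1
  · intro n hn j hj hnj
    have h1 := hkick n hn j hj
    rw [if_neg hnj] at h1
    exact abs_le.2 h1

end EulerSPDE

open EulerSPDE in
theorem corollary3p8 {Ω : Type*} [MeasurableSpace Ω] (μ : Measure Ω) [IsProbabilityMeasure μ]
    (T η : ℝ) (hT : 0 < T) (hη : 0 < η)
    (q : ℕ) (hq : 2 ≤ q) (a : ℕ → ℝ) (ha : a q ≠ 0)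
    (χ ν : ℝ) (hχ : 1 / 4 < χ) (hν₀ : 1 / 4 < ν) (hν₁ : ν < 3 / 4)
    (ξ : H) (hξ : ξ ∈ (fracPow η χ).domain)
    (J : H →L[ℝ] InterpSpace η (-ν)) (hJ : J = embed hη (by linarith))
    (W : ℝ → Ω → InterpSpace η (-ν)) (hW : IsCylindricalWiener J T W μ)
    (S : ℕ → InterpSpace η (-ν) →L[ℝ] H)
    (hS : ∀ N : ℕ, 1 ≤ N → IsExp J (T / N) (S N) ∨ IsResolvent J (T / N) (S N))
    (Y : ℕ → ℕ → Ω → H)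
    (hY₀ : ∀ N : ℕ, 1 ≤ N → ∀ ω, Y N 0 ω = P N ξ)
    (hY : ∀ N : ℕ, 1 ≤ N → ∀ n < N, ∀ ω,
      Y N (n + 1) ω = P N (S N (J (Y N n ω + (T / N) • nemytskii q a (Y N n ω))
        + (W ((n + 1) * T / N) ω - W (n * T / N) ω))))
    (p : ℝ) (hp : 0 < p) :
    liminf (fun N : ℕ => ∫⁻ ω, ‖Y N N ω‖ₑ ^ p ∂μ) atTop = ∞ := by
  -- `D` is the constant error of the drift, `L` bounds the inverse multipliers of the implicit
  -- scheme, `B` the noise, `G` the first drift; `R` is the threshold from which on one step squares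
  -- the state up to the factor `κ`, and a kick of size `M` lifts the scheme above `R`.
  obtain ⟨C, hC⟩ : ∃ C : ℝ, C = 1 + T * ∑ k ∈ Finset.range q, |a k| := ⟨_, rfl⟩
  obtain ⟨D, hD⟩ : ∃ D : ℕ → ℝ,
    D = fun N : ℕ => 2 * C + C * (2 * C / (T * |a q|) * N) ^ (q - 1) := ⟨_, rfl⟩
  obtain ⟨L, hL⟩ : ∃ L : ℕ → ℝ,
    L = fun N : ℕ => 1 + 4 * Real.pi ^ 2 * T * N + T * |a q| := ⟨_, rfl⟩
  obtain ⟨B, hB⟩ : ∃ B : ℝ, B = √(2 * T) := ⟨_, rfl⟩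
  obtain ⟨R, hR⟩ : ∃ R : ℕ → ℝ, R = fun N : ℕ =>
    1 + N / (T * |a q|) * (100 * (D N + L N * ((2 * N + 1) * B)) + 8 * L N) := ⟨_, rfl⟩
  obtain ⟨G, hG⟩ : ∃ G : ℕ → ℝ, G = fun N : ℕ =>
    3 / 2 * (T * |a q|) * ((2 * N + 1) * (‖ξ‖ * 2)) ^ q + D N := ⟨_, rfl⟩
  obtain ⟨M, hM⟩ : ∃ M : ℕ → ℝ, M = fun N : ℕ =>
    2 * G N + R N + (2 * N + 1) * ((2 * G N + B) * 2) := ⟨_, rfl⟩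
  have hlin : PolyBdd fun N : ℕ => 2 * (N : ℝ) + 1 :=
    ((PolyBdd.const 2).mul .natCast).add (.const 1)
  have hDp : PolyBdd D := by
    rw [hD]
    exact (PolyBdd.const _).add ((PolyBdd.const _).mul (((PolyBdd.const _).mul .natCast).pow _))
  have hLp : PolyBdd L := by
    rw [hL]
    exact ((PolyBdd.const _).add ((PolyBdd.const _).mul .natCast)).add (.const _)
  have hRp : PolyBdd R := by
    rw [hR]
    exact (PolyBdd.const _).add ((PolyBdd.natCast.div_const _).mul
      (((PolyBdd.const _).mul (hDp.add (hLp.mul (hlin.mul (.const _))))).add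
        ((PolyBdd.const _).mul hLp)))
  have hGp : PolyBdd G := by
    rw [hG]
    exact ((PolyBdd.const _).mul ((hlin.mul (.const _)).pow _)).add hDp
  have hMp : PolyBdd M := by
    rw [hM]
    exact (((PolyBdd.const _).mul hGp).add hRp).add
      (hlin.mul ((((PolyBdd.const _).mul hGp).add (.const _)).mul (.const _)))
  have hB0 : 0 < B := by rw [hB]; positivity
  have hB2 : 2 * T ≤ B ^ 2 := by rw [hB, Real.sq_sqrt (by positivity)]
  have haq : 0 < |a q| := abs_pos.2 ha
  have hC0 : 0 ≤ C := by
    have : 0 ≤ ∑ k ∈ Finset.range q, |a k| := Finset.sum_nonneg fun _ _ => abs_nonneg _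
    rw [hC]
    positivity
  refine (tendsto_nhds_top_mono (tendsto_gaussianPDF_mul_two_pow hT hp hMp) ?_).liminf_eq
  have htail : ∀ᶠ N in atTop, heatTail T N ≤ 1 / 8 :=
    (tendsto_heatTail T).eventually_le_const (by norm_num)
  filter_upwards [eventually_ge_atTop 1, htail] with N hN hε
  have hN1 : (1 : ℝ) ≤ N := by exact_mod_cast hN
  have hpi := Real.pi_pos
  obtain ⟨s, hs0, hspos, hs1, hSs, hs⟩ := exists_multiplier (by positivity) (hS N hN)
  have hD0 : 0 ≤ D N := by rw [hD]; positivity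
  have hL1 : 1 ≤ L N := by
    rw [hL]
    have : 0 ≤ 4 * Real.pi ^ 2 * T * N + T * |a q| := by positivity
    linarith
  have hLa : T * |a q| ≤ L N := by
    rw [hL]
    have : 0 ≤ 1 + 4 * Real.pi ^ 2 * T * N := by positivity
    linarith
  have hG0 : 0 ≤ G N := by rw [hG]; positivity
  have hR0 : 0 ≤ R N := by rw [hR]; positivity
  have hM0 : 0 ≤ M N := by rw [hM]; positivity
  have hs' : ((∀ n : ℤ, s n = Real.exp (T / N * (-4 * Real.pi ^ 2 * (n : ℝ) ^ 2)))
      ∧ heatTail T N ≤ 1 / 8) ∨ ∀ n ∈ Finset.Icc (-(N : ℤ)) N, 1 ≤ L N * s n := by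
    refine hs.imp (fun h => ⟨h, hε⟩) fun h n hn => ?_
    rw [h n, ← div_eq_mul_inv, one_le_div (by positivity), hL]
    have h1 : (n : ℝ) ^ 2 ≤ (N : ℝ) ^ 2 := by
      rw [Finset.mem_Icc, ← abs_le] at hn
      rw [← sq_abs]
      have : |(n : ℝ)| ≤ N := by exact_mod_cast hn
      exact pow_le_pow_left₀ (abs_nonneg _) this 2
    have h2 : T / N * (4 * Real.pi ^ 2 * (n : ℝ) ^ 2)
        ≤ T / N * (4 * Real.pi ^ 2 * (N : ℝ) ^ 2) := by gcongr
    have h3 : T / N * (4 * Real.pi ^ 2 * (N : ℝ) ^ 2) = 4 * Real.pi ^ 2 * T * N := by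
      field_simp
    have h4 : 0 ≤ T * |a q| := by positivity
    linarith
  obtain ⟨hnull, hprob⟩ := le_measure_kickEvent hW hT hSs hs0 hspos hs1 hN hM0 hB0 hB2
  set K := kickEvent T W (S N) N (M N) B with hK
  have hnorm : ∀ ω ∈ K, ENNReal.ofReal (2 ^ 2 ^ (N - 1)) ^ p ≤ ‖Y N N ω‖ₑ ^ p := by
    intro ω hω
    have h1 := two_pow_two_pow_le_norm hT hN hq ha hSs hs0 hspos hs1 hs' hC (congrFun hD N) hL1
      hLa hB0.le (congrFun hR N) (congrFun hG N) (congrFun hM N) (hY₀ N hN) (hY N hN) hω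
    refine ENNReal.rpow_le_rpow ?_ hp.le
    rw [← ofReal_norm]
    exact ENNReal.ofReal_le_ofReal h1
  calc ENNReal.ofReal (2 ^ 2 ^ (N - 1)) ^ p *
        (ENNReal.ofReal (gaussianPDFReal 0 (T / N).toNNReal (M N + 1))
          * (1 / 2) ^ (N * (2 * N + 1)))
      ≤ ENNReal.ofReal (2 ^ 2 ^ (N - 1)) ^ p * μ K := by gcongr
    _ = ∫⁻ _ in K, ENNReal.ofReal (2 ^ 2 ^ (N - 1)) ^ p ∂μ := (setLIntegral_const _ _).symm
    _ ≤ ∫⁻ ω in K, ‖Y N N ω‖ₑ ^ p ∂μ :=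
        lintegral_mono_ae ((ae_restrict_iff'₀ hnull).2 (Eventually.of_forall hnorm))
    _ ≤ ∫⁻ ω, ‖Y N N ω‖ₑ ^ p ∂μ := setLIntegral_le_lintegral _ _
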